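/- **Notation.** Let $d\in\mathbf N$. For multi-indices $\alpha\in\mathbf N^d$ let $h_\alpha(x)=\prod_{j=1}^d h_{\alpha_j}(x_j)$ be the Hermite functions on $\mathbf R^d$, where $h_n(t)=\pi^{-1/4}(2^nn!)^{-1/2}(-1)^ne^{t^2/2}\frac{d^n}{dt^n}e^{-t^2}$, and let $c(\phi,\alpha)=\int\phi\,h_\alpha\,dx$. * $\mathcal H_\flat(\mathbf R^d)$ is the set of all $\phi=\sum_\alpha c_\alpha h_\alpha$ with $|c_\alpha|\le Ch^{|\alpha|}\alpha!^{-1/2}$ for some $C,h>0$. * $\mathcal H_\flat'(\mathbf R^d)$ is the space of all formal expansions $u=\sum_\alpha c(u,\alpha)h_\alpha$ such that $\|u\|_{h}=\sup_\alpha |c(u,\alpha)|\,h^{-|\alpha|}\alpha!^{-1/2}<\infty$ for every $h>0$, with the Fréchet topology given by these seminorms. It acts on $\phi\in\mathcal H_\flat(\mathbf R^d)$ by $\langle u,\phi\rangle=\sum_\alpha c(u,\alpha)c(\phi,\alpha)$. For $x,\xi\in\mathbf R^d$, $e^{i\langle\cdot,\xi\rangle}u(\cdot-x)\in\mathcal H_\flat'(\mathbf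 R^d)$ is defined by duality: $\langle e^{i\langle\cdot,\xi\rangle}u(\cdot-x),\phi\rangle=\langle u,e^{i\langle\cdot+x,\xi\rangle}\phi(\cdot+x)\rangle$ for all $\phi\in\mathcal H_\flat(\mathbf R^d)$. * $\Sigma_1(\mathbf R^d)$ is the Gelfand–Shilov space of all $f\in C^\infty(\mathbf R^d)$ such that $\sup_{\alpha,\beta,x}\frac{|x^\alpha\partial^\beta f(x)|}{h^{|\alpha+\beta|}\alpha!\,\beta!}<\infty$ for every $h>0$, with the Fréchet topology given by these seminorms. $\Sigma_1'(\mathbf R^d)$ and $\mathscr S'(\mathbf R^d)$ are the strong duals of $\Sigma_1(\mathbf R^d)$ and of the Schwartz space $\mathscr S(\mathbf R^d)$. They are regarded as subspaces of $\mathcal H_\flat'(\mathbf R^d)$: $u$ in $\Sigma_1'$ (resp. $\mathscr S'$) is identified with the formal expansion $w$ such that $u(\phi)=\sum_\alpha c(w,\alpha)c(\phi,\alpha)$ for all $\phi$ in $\Sigma_1$ (resp. $\mathscr S$). * A quasi-norm on a complex vector space $\mathcal B$ is a map $\|\cdot\|_{\mathcal B}:\mathcal B\to[0,\infty)$, vanishing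 only at $0$, with $\|af\|_{\mathcal B}=|a|\,\|f\|_{\mathcal B}$ for $a\in\mathbf C$ and, for some $p\in(0,1]$, $\|f+g\|_{\mathcal B}^p\le\|f\|_{\mathcal B}^p+\|g\|_{\mathcal B}^p$. A quasi-Banach space is a space with a quasi-norm that is complete in the topology defined by it. **Proposition 3.2.** Let $\mathcal B$ be a quasi-Banach space which is continuously embedded in $\mathcal H_\flat'(\mathbf R^d)$, and suppose that for some constant $C>0$ and some function $v\in L^\infty_{loc}(\mathbf R^{2d};\mathbf R_+)$ (everywhere defined, positive, and essentially bounded on compact sets), one has $e^{i\langle\cdot,\xi\rangle}f(\cdot-x)\in\mathcal B$ and $$\|e^{i\langle\cdot,\xi\rangle}f(\cdot-x)\|_{\mathcal B}\le C\,v(x,\xi)\,\|f\|_{\mathcal B}\qquad\text{for all } f\in\mathcal B,\ x,\xi\in\mathbf R^d.$$ Then: 1. $\mathcal B$ is continuously embedded in $\Sigma_1'(\mathbf R^d)$; 2. if in addition $v(x,\xi)\le C_0(1+|x|+|\xi|)^N$ for all $x,\xi\in\mathbf R^d$, for some constants $C_0>0$ and $N>0$, then $\mathcal B$ is continuously embedded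 in $\mathscr S'(\mathbf R^d)$. (The embeddings in 1 and 2 are compatible with the given embedding into $\mathcal H_\flat'(\mathbf R^d)$ under the identifications above.) -/

import Mathlib

open scoped SchwartzMap ENNReal RealInnerProductSpace

noncomputable section

namespace PilipovicSpaces

/-! ### Multi-indices and Hermite functions -/

/-- Multi-indices `α ∈ ℕᵈ`. -/
abbrev MultiIndex (d : ℕ) : Type := Fin d → ℕ

/-- Euclidean space `ℝᵈ`. -/
abbrev Space (d : ℕ) : Type := EuclideanSpace ℝ (Fin d)

/-- The length `|α| = α₁ + ⋯ + α_d`. -/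
def MultiIndex.length {d : ℕ} (α : MultiIndex d) : ℕ := ∑ i, α i

/-- The factorial `α! = α₁! ⋯ α_d!`. -/
def MultiIndex.fact {d : ℕ} (α : MultiIndex d) : ℕ := ∏ i, (α i).factorial

/-- The one-dimensional normalised Hermite function
`hₙ(t) = π^(-1/4) (2ⁿ n!)^(-1/2) Hₙ(t) e^(-t²/2)`, where `Hₙ(t) = (-1)ⁿ e^(t²) (d/dt)ⁿ e^(-t²)`.
Mathlib's `Polynomial.hermite n` is the probabilists' polynomial `Heₙ`, and
`Hₙ(t) = 2^(n/2) Heₙ(√2 t)`. -/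
def hermiteFun (n : ℕ) (t : ℝ) : ℝ :=
  Real.pi ^ (-(1 / 4) : ℝ) * (Real.sqrt (n.factorial : ℝ))⁻¹ *
    Polynomial.aeval (Real.sqrt 2 * t) (Polynomial.hermite n) * Real.exp (-(t ^ 2) / 2)

/-- The Hermite function `h_α(x) = h_{α₁}(x₁) ⋯ h_{α_d}(x_d)` on `ℝᵈ`. -/
def hermiteFn {d : ℕ} (α : MultiIndex d) (x : Space d) : ℝ := ∏ i, hermiteFun (α i) (x i)

/-- The Hermite coefficient `c(φ, α) = ∫ φ(x) h_α(x) dx` (the `h_α` are real valued). -/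
def hermiteCoeff {d : ℕ} (φ : Space d → ℂ) (α : MultiIndex d) : ℂ :=
  ∫ x, φ x * (hermiteFn α x : ℂ)

/-! ### The supremum of a family of linear functionals as a seminorm -/

/-- The seminorm `v ↦ sup_q |a_q(v)|` of a pointwise bounded family of linear functionals. -/
def supSeminorm {V Q : Type*} [AddCommGroup V] [Module ℂ V] [Nonempty Q] (a : Q → V →ₗ[ℂ] ℂ)
    (ha : ∀ v, BddAbove (Set.range fun q => ‖a q v‖)) : Seminorm ℂ V :=
  Seminorm.of (fun v => ⨆ q, ‖a q v‖)
    (fun v w => ciSup_le fun q => by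
      rw [map_add]
      exact (norm_add_le _ _).trans (add_le_add (le_ciSup (ha v) q) (le_ciSup (ha w) q)))
    (fun r v => by
      simp only [map_smul, smul_eq_mul, norm_mul]
      exact (Real.mul_iSup_of_nonneg (norm_nonneg r) _).symm)

/-! ### The Pilipović space `H_♭` and its distribution space `H_♭'` -/

/-- The Pilipović space `H_♭(ℝᵈ)`: the Hermite expansions `φ = ∑ c_α h_α` with
`|c_α| ≤ C h^|α| (α!)^(-1/2)` for some `C` and some `h > 0`. -/
def HFlat (d : ℕ) : Set (Space d → ℂ) :=
  {φ | ∃ c : MultiIndex d → ℂ,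
    (∃ h : ℝ, 0 < h ∧ ∃ C : ℝ, ∀ α, ‖c α‖ ≤ C * h ^ α.length * (Real.sqrt α.fact)⁻¹) ∧
    ∀ x, HasSum (fun α => c α * (hermiteFn α x : ℂ)) (φ x)}

/-- The coefficient families of formal Hermite expansions `∑ c_α h_α` such that for every `h > 0`
there is `C` with `|c_α| ≤ C h^|α| (α!)^(1/2)`. -/
def hFlatDualSubmodule (d : ℕ) : Submodule ℂ (MultiIndex d → ℂ) where
  carrier := {c | ∀ h : ℝ, 0 < h → ∃ C : ℝ, ∀ α, ‖c α‖ ≤ C * (h ^ α.length * Real.sqrt α.fact)}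
  zero_mem' := fun h _ => ⟨0, fun α => by simp⟩
  add_mem' := fun {c c'} hc hc' h hh => by
    obtain ⟨C, hC⟩ := hc h hh
    obtain ⟨C', hC'⟩ := hc' h hh
    refine ⟨C + C', fun α => (norm_add_le _ _).trans ?_⟩
    rw [add_mul]
    exact add_le_add (hC α) (hC' α)
  smul_mem' := fun r c hc h hh => by
    obtain ⟨C, hC⟩ := hc h hh
    refine ⟨‖r‖ * C, fun α => ?_⟩
    rw [Pi.smul_apply, norm_smul, mul_assoc]
    exact mul_le_mul_of_nonneg_left (hC α) (norm_nonneg r)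

/-- The Pilipović distribution space `H_♭'(ℝᵈ)`, the space of formal Hermite expansions whose
coefficients lie in `hFlatDualSubmodule d`; its topology is given below. -/
def HFlatDual (d : ℕ) : Type := hFlatDualSubmodule d

namespace HFlatDual

variable {d : ℕ}

instance : AddCommGroup (HFlatDual d) := inferInstanceAs (AddCommGroup (hFlatDualSubmodule d))

instance : Module ℂ (HFlatDual d) := inferInstanceAs (Module ℂ (hFlatDualSubmodule d))

/-- The Hermite coefficients `c(u, α)` of `u ∈ H_♭'`. -/
def coeff : HFlatDual d →ₗ[ℂ] (MultiIndex d → ℂ) := (hFlatDualSubmodule d).subtype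

/-- The functional `u ↦ c(u, α) / (h^|α| (α!)^(1/2))`. -/
def weightedCoeff (h : ℝ) (α : MultiIndex d) : HFlatDual d →ₗ[ℂ] ℂ :=
  ((h ^ α.length * Real.sqrt α.fact : ℝ) : ℂ)⁻¹ • (LinearMap.proj α ∘ₗ coeff)

theorem norm_weightedCoeff {h : ℝ} (hh : 0 < h) (α : MultiIndex d) (u : HFlatDual d) :
    ‖weightedCoeff h α u‖ = ‖coeff u α‖ / (h ^ α.length * Real.sqrt α.fact) := by
  have : 0 ≤ h ^ α.length * Real.sqrt α.fact := by positivity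
  simp only [weightedCoeff, LinearMap.smul_apply, LinearMap.comp_apply, LinearMap.proj_apply,
    smul_eq_mul, norm_mul, norm_inv, Complex.norm_real, Real.norm_of_nonneg this]
  rw [div_eq_inv_mul]

theorem bddAbove_weightedCoeff (h : {h : ℝ // 0 < h}) (u : HFlatDual d) :
    BddAbove (Set.range fun α => ‖weightedCoeff h.1 α u‖) := by
  obtain ⟨C, hC⟩ := u.2 h.1 h.2
  refine ⟨C, ?_⟩
  rintro _ ⟨α, rfl⟩
  have hf : 0 < α.fact := Finset.prod_pos fun i _ => Nat.factorial_pos _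
  have hp : 0 < h.1 ^ α.length * Real.sqrt α.fact :=
    mul_pos (pow_pos h.2 _) (Real.sqrt_pos.2 (by exact_mod_cast hf))
  simp only [norm_weightedCoeff h.2]
  rw [div_le_iff₀ hp]
  exact hC α

/-- The seminorms `‖u‖_h = sup_α |c(u, α)| / (h^|α| (α!)^(1/2))`, `h > 0`, of `H_♭'`. -/
def seminorms (d : ℕ) : SeminormFamily ℂ (HFlatDual d) {h : ℝ // 0 < h} :=
  fun h => supSeminorm (weightedCoeff h.1) (bddAbove_weightedCoeff h)

/-- The projective limit (Fréchet) topology of `H_♭'`. -/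
instance : TopologicalSpace (HFlatDual d) := (seminorms d).moduleFilterBasis.topology

theorem withSeminorms : WithSeminorms (seminorms d) := ⟨rfl⟩

/-- The (bilinear) action `⟨u, φ⟩ = ∑_α c(u, α) c(φ, α)` of `u ∈ H_♭'` on a test function;
it is related to the sesquilinear one by `⟨u, φ⟩ = (u, conj φ)`. -/
def pairing (u : HFlatDual d) (φ : Space d → ℂ) : ℂ := ∑' α, coeff u α * hermiteCoeff φ α

/-- `IsTimeFrequencyShift x ξ u w` says that `w = e^{i⟨·,ξ⟩} u(· - x)` in `H_♭'`, in the sense of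
duality: `⟨w, φ⟩ = ⟨u, e^{i⟨· + x, ξ⟩} φ(· + x)⟩` for all test functions `φ ∈ H_♭`. -/
def IsTimeFrequencyShift (x ξ : Space d) (u w : HFlatDual d) : Prop :=
  ∀ φ ∈ HFlat d,
    pairing w φ =
      pairing u (fun y => Complex.exp (Complex.I * ((⟪y + x, ξ⟫ : ℝ) : ℂ)) * φ (y + x))

end HFlatDual

/-! ### The Gelfand–Shilov space `Σ₁` -/

/-- The monomial `x^α`. -/
def monomial {d : ℕ} (α : MultiIndex d) (x : Space d) : ℝ := ∏ i, x i ^ α i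

/-- The partial derivative `∂^β = ∂₁^{β₁} ⋯ ∂_d^{β_d}`, acting on Schwartz functions. -/
def partialDeriv {d : ℕ} (β : MultiIndex d) : 𝓢(Space d, ℂ) →L[ℂ] 𝓢(Space d, ℂ) :=
  (List.ofFn fun i : Fin d =>
    (LineDeriv.lineDerivOpCLM ℂ 𝓢(Space d, ℂ) (EuclideanSpace.single i (1 : ℝ))) ^ β i).prod

/-- The Gelfand–Shilov space as a subspace of the Schwartz space: for every `h > 0` there is `C`
with `|x^α ∂^β f(x)| ≤ C h^|α+β| α! β!` for all `α`, `β`, `x`. (A smooth function with these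
bounds is automatically a Schwartz function.) -/
def sigmaOneSubmodule (d : ℕ) : Submodule ℂ 𝓢(Space d, ℂ) where
  carrier := {f | ∀ h : ℝ, 0 < h → ∃ C : ℝ, ∀ (α β : MultiIndex d) (x : Space d),
    ‖(monomial α x : ℂ) * partialDeriv β f x‖ ≤ C * (h ^ (α + β).length * α.fact * β.fact)}
  zero_mem' := fun h _ => ⟨0, fun α β x => by simp⟩
  add_mem' := fun {f g} hf hg h hh => by
    obtain ⟨C, hC⟩ := hf h hh
    obtain ⟨C', hC'⟩ := hg h hh
    refine ⟨C + C', fun α β x => ?_⟩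
    rw [map_add, add_apply, mul_add, add_mul]
    exact (norm_add_le _ _).trans (add_le_add (hC α β x) (hC' α β x))
  smul_mem' := fun r f hf h hh => by
    obtain ⟨C, hC⟩ := hf h hh
    refine ⟨‖r‖ * C, fun α β x => ?_⟩
    rw [map_smul, smul_apply, smul_eq_mul, mul_left_comm, norm_mul, mul_assoc]
    exact mul_le_mul_of_nonneg_left (hC α β x) (norm_nonneg r)

/-- The Gelfand–Shilov space `Σ₁(ℝᵈ)`; it carries its own (Fréchet) topology, given below, and not
the topology induced by the Schwartz space. -/
def SigmaOne (d : ℕ) : Type := sigmaOneSubmodule d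

namespace SigmaOne

variable {d : ℕ}

instance : AddCommGroup (SigmaOne d) := inferInstanceAs (AddCommGroup (sigmaOneSubmodule d))

instance : Module ℂ (SigmaOne d) := inferInstanceAs (Module ℂ (sigmaOneSubmodule d))

/-- The inclusion `Σ₁ ⊆ 𝓢`. -/
def toSchwartz : SigmaOne d →ₗ[ℂ] 𝓢(Space d, ℂ) := (sigmaOneSubmodule d).subtype

/-- The functional `f ↦ x^α ∂^β f(x) / (h^|α+β| α! β!)`, for `q = (α, β, x)`. -/
def weightedDeriv (h : ℝ) (q : MultiIndex d × MultiIndex d × Space d) : SigmaOne d →ₗ[ℂ] ℂ where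
  toFun f := ((h ^ (q.1 + q.2.1).length * q.1.fact * q.2.1.fact : ℝ) : ℂ)⁻¹ *
    ((monomial q.1 q.2.2 : ℂ) * partialDeriv q.2.1 (toSchwartz f) q.2.2)
  map_add' f g := by
    rw [map_add, map_add, add_apply, mul_add, mul_add]
  map_smul' r f := by
    rw [map_smul, map_smul, smul_apply, RingHom.id_apply, smul_eq_mul, smul_eq_mul]
    ring

theorem norm_weightedDeriv {h : ℝ} (hh : 0 < h) (q : MultiIndex d × MultiIndex d × Space d)
    (f : SigmaOne d) :
    ‖weightedDeriv h q f‖ = ‖(monomial q.1 q.2.2 : ℂ) * partialDeriv q.2.1 (toSchwartz f) q.2.2‖ /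
      (h ^ (q.1 + q.2.1).length * q.1.fact * q.2.1.fact) := by
  have : 0 ≤ h ^ (q.1 + q.2.1).length * (q.1.fact : ℝ) * q.2.1.fact := by positivity
  change ‖((h ^ (q.1 + q.2.1).length * q.1.fact * q.2.1.fact : ℝ) : ℂ)⁻¹ *
    ((monomial q.1 q.2.2 : ℂ) * partialDeriv q.2.1 (toSchwartz f) q.2.2)‖ = _
  rw [norm_mul, norm_inv, Complex.norm_real, Real.norm_of_nonneg this, div_eq_inv_mul]

theorem bddAbove_weightedDeriv (h : {h : ℝ // 0 < h}) (f : SigmaOne d) :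
    BddAbove (Set.range fun q => ‖weightedDeriv h.1 q f‖) := by
  obtain ⟨C, hC⟩ := f.2 h.1 h.2
  refine ⟨C, ?_⟩
  rintro _ ⟨q, rfl⟩
  have h1 : 0 < q.1.fact := Finset.prod_pos fun i _ => Nat.factorial_pos _
  have h2 : 0 < q.2.1.fact := Finset.prod_pos fun i _ => Nat.factorial_pos _
  have hp : 0 < h.1 ^ (q.1 + q.2.1).length * (q.1.fact : ℝ) * q.2.1.fact :=
    mul_pos (mul_pos (pow_pos h.2 _) (by exact_mod_cast h1)) (by exact_mod_cast h2)
  simp only [norm_weightedDeriv h.2]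
  rw [div_le_iff₀ hp]
  exact hC q.1 q.2.1 q.2.2

/-- The seminorms `‖f‖_h = sup_{α, β, x} |x^α ∂^β f(x)| / (h^|α+β| α! β!)`, `h > 0`, of `Σ₁`:
the smallest constants `C_h` in the defining bounds. -/
def seminorms (d : ℕ) : SeminormFamily ℂ (SigmaOne d) {h : ℝ // 0 < h} :=
  fun h => supSeminorm (weightedDeriv h.1) (bddAbove_weightedDeriv h)

/-- The projective limit (Fréchet) topology of `Σ₁`. -/
instance : TopologicalSpace (SigmaOne d) := (seminorms d).moduleFilterBasis.topology

theorem withSeminorms : WithSeminorms (seminorms d) := ⟨rfl⟩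

end SigmaOne

/-- The Gelfand–Shilov distribution space `Σ₁'(ℝᵈ)`, the strong dual of `Σ₁(ℝᵈ)`. -/
abbrev SigmaOneDual (d : ℕ) : Type := StrongDual ℂ (SigmaOne d)

/-- The space `𝓢'(ℝᵈ)` of tempered distributions, the strong dual of the Schwartz space
(Mathlib's `TemperedDistribution` carries the weak-* topology instead). -/
abbrev SchwartzDual (d : ℕ) : Type := StrongDual ℂ 𝓢(Space d, ℂ)

/-- `u ∈ Σ₁'` and `w ∈ H_♭'` are the same distribution under the inclusion `Σ₁' ⊆ H_♭'`:
the action of `u` is given by the Hermite expansion `w`. -/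
def SigmaOneDual.Represents {d : ℕ} (u : SigmaOneDual d) (w : HFlatDual d) : Prop :=
  ∀ φ : SigmaOne d,
    HasSum (fun α => HFlatDual.coeff w α * hermiteCoeff (SigmaOne.toSchwartz φ) α) (u φ)

/-- `u ∈ 𝓢'` and `w ∈ H_♭'` are the same distribution under the inclusion `𝓢' ⊆ H_♭'`:
the action of `u` is given by the Hermite expansion `w`. -/
def SchwartzDual.Represents {d : ℕ} (u : SchwartzDual d) (w : HFlatDual d) : Prop :=
  ∀ φ : 𝓢(Space d, ℂ), HasSum (fun α => HFlatDual.coeff w α * hermiteCoeff φ α) (u φ)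

/-! ### Quasi-Banach spaces -/

/-- `N` is a quasi-norm on the complex vector space `B` (of some order `p ∈ (0, 1]`). -/
structure IsQuasiNorm {B : Type*} [AddCommGroup B] [Module ℂ B] (N : B → ℝ) : Prop where
  nonneg : ∀ f, 0 ≤ N f
  eq_zero : ∀ f, N f = 0 → f = 0
  smul : ∀ (a : ℂ) (f : B), N (a • f) = ‖a‖ * N f
  add : ∃ p : ℝ, 0 < p ∧ p ≤ 1 ∧ ∀ f g, N (f + g) ^ p ≤ N f ^ p + N g ^ p

/-- `B` is a quasi-Banach space with quasi-norm `N`: its topology and uniformity are those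
defined by the quasi-norm `N`, and it is complete. -/
structure IsQuasiBanach {B : Type*} [AddCommGroup B] [Module ℂ B] [UniformSpace B]
    (N : B → ℝ) : Prop extends IsQuasiNorm N where
  isUniformAddGroup : IsUniformAddGroup B
  hasBasis_nhds_zero : (nhds (0 : B)).HasBasis (fun r : ℝ => 0 < r) (fun r => {f | N f < r})
  complete : CompleteSpace B

end PilipovicSpaces

end

/-! Everything is read off from pairings with the Gaussians `exp(w · y - |y|²/2)`, `w ∈ ℂᵈ`. The
`α`-th Hermite coefficient of such a Gaussian is, up to a factor independent of `α`, `(α!)^(-1/2)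
(w/√2)^α`. Hence pairing `u ∈ H_♭'` with it gives the Bargmann transform of `u`, an entire function
with Taylor coefficients `c(u, α) (α!)^(-1/2)`. With the right Gaussian weight, the modulus of this
pairing is `gaussianTransform u w`.

A time-frequency shift by `(x, ξ)` maps Gaussians to multiples of Gaussians and acts on
`gaussianTransform` as the translation by `iξ - x` (`gaussianTransform_of_isTimeFrequencyShift`). At
`w = 0` the transform is a multiple of `|c(u, 0)|`, which the continuous embedding bounds by the
quasi-norm. So the transform of `f ∈ B` at `w` is at most a constant times the cost of the shift
leading from `0` to `w`, times the quasi-norm of `f`. Cauchy's estimate on the torus `|w_i|² = 2(α_i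
+ 1)` turns this into a bound for `c(f, α)`; by Stirling the Gaussian weight is lost only up to a
polynomial in `|α|` (`norm_coeff_le_of_gaussianTransform_le`, `exists_norm_coeff_le_of_shiftBound`).

On that torus `|w|² = 2(|α| + d)`. A polynomial weight `v` therefore gives coefficients of
polynomial growth. A merely locally bounded `v` gives, by composing unit shifts, a cost exponential
in `|w|`, hence coefficients `O(exp(r √|α|))` for some `r` (`exists_shiftBound_pow`). These growths
are matched by the decay of Hermite coefficients of test functions: rapid for Schwartz functions
(`exists_schwartz_seminorm_le`), faster than every `exp(-r √|α|)` for functions in `Σ₁`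
(`exists_sigmaOne_seminorm_le`). Both decays come from iterating the harmonic oscillator, of which
the Hermite functions are eigenfunctions.

The series `∑ c(f, α) c(φ, α)` then converges absolutely, with a bound that makes it continuous into
the strong dual (`exists_continuousLinearMap_strongDual`). The map is injective because the
Gaussians lie in both test spaces and determine an element of `H_♭'`. -/

namespace PilipovicSpaces

/-! ### One-dimensional Hermite functions -/

/-- A Stirling-type upper bound for the factorial. -/
theorem factorial_mul_exp_le (n : ℕ) :
    (n.factorial : ℝ) * Real.exp n ≤ Real.exp 1 * ((n : ℝ) + 1) ^ (n + 1) := by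
  induction n with
  | zero => simp
  | succ n ih =>
    have h1 : ((n : ℝ) + 1) / (n + 2) ≤ Real.exp (-(1 / ((n : ℝ) + 2))) := by
      have := Real.add_one_le_exp (-(1 / ((n : ℝ) + 2)))
      refine le_trans (le_of_eq ?_) this
      field_simp
      ring
    have h2 : (((n : ℝ) + 1) / (n + 2)) ^ (n + 2) ≤ Real.exp (-1) := by
      refine (pow_le_pow_left₀ (by positivity) h1 _).trans (le_of_eq ?_)
      rw [← Real.exp_nat_mul]
      congr 1
      push_cast
      field_simp
    have h3 : ((n : ℝ) + 1) ^ (n + 2) * Real.exp 1 ≤ ((n : ℝ) + 2) ^ (n + 2) := by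
      rw [div_pow, div_le_iff₀ (by positivity)] at h2
      calc ((n : ℝ) + 1) ^ (n + 2) * Real.exp 1
          ≤ (Real.exp (-1) * ((n : ℝ) + 2) ^ (n + 2)) * Real.exp 1 := by gcongr
        _ = (Real.exp (-1) * Real.exp 1) * ((n : ℝ) + 2) ^ (n + 2) := by ring
        _ = _ := by rw [← Real.exp_add]; simp
    rw [Nat.factorial_succ]
    push_cast
    rw [Real.exp_add]
    calc ((n : ℝ) + 1) * n.factorial * (Real.exp n * Real.exp 1)
        = ((n.factorial : ℝ) * Real.exp n) * (((n : ℝ) + 1) * Real.exp 1) := by ring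
      _ ≤ (Real.exp 1 * ((n : ℝ) + 1) ^ (n + 1)) * (((n : ℝ) + 1) * Real.exp 1) := by gcongr
      _ = Real.exp 1 * (((n : ℝ) + 1) ^ (n + 2) * Real.exp 1) := by ring
      _ ≤ Real.exp 1 * ((n : ℝ) + 2) ^ (n + 2) := by gcongr
      _ = _ := by ring

/-- The loss in the Cauchy estimate of the `n`-th coefficient on the circle of radius `√(n + 1)`
against a Gaussian. -/
theorem sqrt_factorial_mul_exp_le (n : ℕ) :
    Real.sqrt n.factorial * Real.exp (((n : ℝ) + 1) / 2) ≤
      Real.exp 1 * ((n : ℝ) + 1) * Real.sqrt ((n : ℝ) + 1) ^ n := by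
  have hs : (Real.sqrt ((n : ℝ) + 1)) ^ 2 = (n : ℝ) + 1 := Real.sq_sqrt (by positivity)
  refine abs_le_of_sq_le_sq' ?_ (by positivity) |>.2
  have e1 : Real.exp (((n : ℝ) + 1) / 2) ^ 2 = Real.exp n * Real.exp 1 := by
    rw [← Real.exp_nat_mul, ← Real.exp_add]
    congr 1
    push_cast
    ring
  have e2 : (Real.sqrt ((n : ℝ) + 1) ^ n) ^ 2 = ((n : ℝ) + 1) ^ n := by
    rw [← pow_mul, mul_comm n 2, pow_mul, hs]
  rw [mul_pow, mul_pow, mul_pow, e1, e2, Real.sq_sqrt (by positivity)]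
  calc (n.factorial : ℝ) * (Real.exp n * Real.exp 1)
      = (n.factorial : ℝ) * Real.exp n * Real.exp 1 := by ring
    _ ≤ (Real.exp 1 * ((n : ℝ) + 1) ^ (n + 1)) * Real.exp 1 := by
        exact mul_le_mul_of_nonneg_right (factorial_mul_exp_le n) (by positivity)
    _ = Real.exp 1 ^ 2 * (((n : ℝ) + 1) ^ (n + 1)) := by ring
    -- A further factor `n + 1` is given away so that the bound becomes a perfect square.
    _ ≤ Real.exp 1 ^ 2 * (((n : ℝ) + 1) ^ (n + 1) * (n + 1)) := by
        gcongr
        exact le_mul_of_one_le_right (by positivity) (by linarith [n.cast_nonneg (α := ℝ)])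
    _ = _ := by ring

/-- The generating function `ζ ↦ exp(yζ - ζ²/2)` of the Hermite polynomials. -/
noncomputable def hermiteGen (y ζ : ℂ) : ℂ := Complex.exp (y * ζ - ζ ^ 2 / 2)

theorem hasDerivAt_hermiteGen (y ζ : ℂ) :
    HasDerivAt (hermiteGen y) ((y - ζ) * hermiteGen y ζ) ζ := by
  have h : HasDerivAt (fun ζ : ℂ => y * ζ - ζ ^ 2 / 2) (y - ζ) ζ := by
    exact (((hasDerivAt_id' ζ).const_mul y).fun_sub
      (((hasDerivAt_id' ζ).fun_pow 2).div_const 2)).congr_deriv (by simp)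
  have := h.cexp
  rw [mul_comm] at this
  exact this

theorem differentiable_hermiteGen (y : ℂ) : Differentiable ℂ (hermiteGen y) :=
  fun ζ => (hasDerivAt_hermiteGen y ζ).differentiableAt

/-- The product rule for one more derivative is exactly the recursion `He_{n+1} = X He_n - He_n'`.
-/
theorem iteratedDeriv_hermiteGen (y : ℂ) (n : ℕ) :
    iteratedDeriv n (hermiteGen y) =
      fun ζ => Polynomial.aeval (y - ζ) (Polynomial.hermite n) * hermiteGen y ζ := by
  induction n with
  | zero => ext ζ; simp
  | succ n ih =>
    rw [iteratedDeriv_succ, ih]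
    ext ζ
    have h1 : HasDerivAt (fun ζ : ℂ => Polynomial.aeval (y - ζ) (Polynomial.hermite n))
        (-Polynomial.aeval (y - ζ) (Polynomial.derivative (Polynomial.hermite n))) ζ := by
      exact (((Polynomial.hermite n).hasDerivAt_aeval (y - ζ)).comp ζ
        ((hasDerivAt_id' ζ).const_sub y)).congr_deriv (by simp)
    rw [(h1.fun_mul (hasDerivAt_hermiteGen y ζ)).deriv, Polynomial.hermite_succ]
    simp only [map_sub, map_mul, Polynomial.aeval_X]
    ring

theorem iteratedDeriv_hermiteGen_zero (y : ℂ) (n : ℕ) :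
    iteratedDeriv n (hermiteGen y) 0 = Polynomial.aeval y (Polynomial.hermite n) := by
  rw [iteratedDeriv_hermiteGen]
  simp [hermiteGen]

theorem hasSum_hermiteGen (y ζ : ℂ) :
    HasSum (fun n : ℕ => ζ ^ n / n.factorial * Polynomial.aeval y (Polynomial.hermite n))
      (hermiteGen y ζ) := by
  have := Complex.hasSum_taylorSeries_of_entire (differentiable_hermiteGen y) 0 ζ
  refine this.congr_fun fun n => ?_
  rw [iteratedDeriv_hermiteGen_zero, smul_eq_mul, smul_eq_mul, sub_zero]
  ring

theorem ofReal_aeval_hermite (y : ℝ) (n : ℕ) :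
    ((Polynomial.aeval y (Polynomial.hermite n) : ℝ) : ℂ) =
      Polynomial.aeval (y : ℂ) (Polynomial.hermite n) := by
  have := Polynomial.aeval_algebraMap_apply ℂ y (Polynomial.hermite n)
  simpa using this.symm

/-- The generating function of the Hermite functions. -/
theorem hasSum_hermiteFun (t : ℝ) (ζ : ℂ) :
    HasSum (fun n : ℕ => ζ ^ n / (Real.sqrt n.factorial : ℂ) * (hermiteFun n t : ℂ))
      ((Real.pi ^ (-(1 / 4) : ℝ) : ℝ) *
        Complex.exp (-(t : ℂ) ^ 2 / 2 + Real.sqrt 2 * t * ζ - ζ ^ 2 / 2)) := by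
  have h := (hasSum_hermiteGen ((Real.sqrt 2 * t : ℝ) : ℂ) ζ).mul_left
    (((Real.pi ^ (-(1 / 4) : ℝ) : ℝ) : ℂ) * Complex.exp (-(t : ℂ) ^ 2 / 2))
  convert! h using 1
  · ext n
    have hn : (Real.sqrt n.factorial : ℂ) * (Real.sqrt n.factorial : ℂ) = n.factorial := by
      rw [← Complex.ofReal_mul, Real.mul_self_sqrt (by positivity)]
      simp
    have hn0 : (Real.sqrt n.factorial : ℂ) ≠ 0 := by
      have : Real.sqrt n.factorial ≠ 0 := by positivity
      exact_mod_cast this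
    rw [← hn, ← ofReal_aeval_hermite]
    simp only [hermiteFun]
    push_cast
    field_simp
  · rw [hermiteGen, mul_assoc _ (Complex.exp _) (Complex.exp _), ← Complex.exp_add]
    congr 2
    push_cast
    ring

/-- Completing the square. For `y = √2 t` the term `y²/4` is cancelled by the factor `exp(-t²/2)` of
the Hermite function, and the remaining square supplies decay in `t`. -/
theorem re_hermiteGen_exponent (y : ℝ) (ζ : ℂ) :
    ((y : ℂ) * ζ - ζ ^ 2 / 2).re = y ^ 2 / 4 + ‖ζ‖ ^ 2 / 2 - (y / 2 - ζ.re) ^ 2 := by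
  have h : ((y : ℂ) * ζ - ζ ^ 2 / 2).re = y * ζ.re - (ζ.re ^ 2 - ζ.im ^ 2) / 2 := by
    simp [pow_two]
  rw [h, ← Complex.normSq_eq_norm_sq, Complex.normSq_apply]
  ring

/-- A Gaussian centred at distance at most `r` from the origin absorbs quadratic growth at a cost of
order `1 + r²`, by `1 + u ≤ exp u`. -/
theorem one_add_sq_mul_exp_le (s c r : ℝ) (hc : |c| ≤ r) :
    (1 + 2 * s ^ 2) * Real.exp (-(s - c) ^ 2) ≤ 4 * (1 + 4 * r ^ 2) := by
  have h1 : 1 + (s - c) ^ 2 ≤ Real.exp ((s - c) ^ 2) := by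
    linarith [Real.add_one_le_exp ((s - c) ^ 2)]
  have hcr : c ^ 2 ≤ r ^ 2 := sq_le_sq' (by linarith [neg_abs_le c]) (by linarith [le_abs_self c])
  rw [Real.exp_neg, ← div_eq_mul_inv, div_le_iff₀ (Real.exp_pos _)]
  have h2 : 1 + 2 * s ^ 2 ≤ (1 + 4 * r ^ 2) * (4 * (1 + (s - c) ^ 2)) := by
    nlinarith [sq_nonneg (s - 2 * c), mul_nonneg (sq_nonneg r) (sq_nonneg (s - c)), sq_nonneg r]
  calc 1 + 2 * s ^ 2 ≤ (1 + 4 * r ^ 2) * (4 * (1 + (s - c) ^ 2)) := h2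
    _ ≤ (1 + 4 * r ^ 2) * (4 * Real.exp ((s - c) ^ 2)) := by gcongr
    _ = _ := by ring

/-- Hermite functions decay at least quadratically, with constants polynomial in the degree. -/
theorem abs_hermiteFun_le (n : ℕ) (t : ℝ) :
    (1 + t ^ 2) * |hermiteFun n t| ≤ 64 * ((n : ℝ) + 1) ^ 2 := by
  -- Radius for Cauchy's estimate: here `n! exp(r²/2) / r^n` exceeds `√n!` by a polynomial factor
  -- only.
  set r : ℝ := Real.sqrt ((n : ℝ) + 1) with hr
  have hr0 : 0 < r := Real.sqrt_pos.2 (by positivity)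
  have hr2 : r ^ 2 = (n : ℝ) + 1 := Real.sq_sqrt (by positivity)
  set y : ℝ := Real.sqrt 2 * t with hy
  have hy2 : y ^ 2 = 2 * t ^ 2 := by rw [hy, mul_pow, Real.sq_sqrt (by norm_num)]
  have hpos : 0 < (1 + t ^ 2) * Real.exp (-t ^ 2 / 2) := by positivity
  have hC : ∀ ζ ∈ Metric.sphere (0 : ℂ) r, ‖hermiteGen y ζ‖ ≤
      4 * (1 + 4 * r ^ 2) * Real.exp (r ^ 2 / 2) / ((1 + t ^ 2) * Real.exp (-t ^ 2 / 2)) := by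
    intro ζ hζ
    have hζr : ‖ζ‖ = r := by simpa using hζ
    rw [le_div_iff₀ hpos, hermiteGen, Complex.norm_exp, re_hermiteGen_exponent, hζr, hy2]
    have hre : |ζ.re| ≤ r := hζr ▸ Complex.abs_re_le_norm ζ
    have key := one_add_sq_mul_exp_le (y / 2) ζ.re r hre
    have hs : 1 + 2 * (y / 2) ^ 2 = 1 + t ^ 2 := by rw [div_pow, hy2]; ring
    rw [hs] at key
    calc Real.exp (2 * t ^ 2 / 4 + r ^ 2 / 2 - (y / 2 - ζ.re) ^ 2) *
          ((1 + t ^ 2) * Real.exp (-t ^ 2 / 2))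
        = (1 + t ^ 2) * (Real.exp (2 * t ^ 2 / 4 + r ^ 2 / 2 - (y / 2 - ζ.re) ^ 2) *
          Real.exp (-t ^ 2 / 2)) := by ring
      _ = (1 + t ^ 2) * (Real.exp (-(y / 2 - ζ.re) ^ 2) * Real.exp (r ^ 2 / 2)) := by
          rw [← Real.exp_add, ← Real.exp_add]
          congr 2
          ring
      _ = ((1 + t ^ 2) * Real.exp (-(y / 2 - ζ.re) ^ 2)) * Real.exp (r ^ 2 / 2) := by ring
      _ ≤ _ := by gcongr
  have hcauchy := Complex.norm_iteratedDeriv_le_of_forall_mem_sphere_norm_le n hr0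
    (differentiable_hermiteGen (y : ℂ)).diffContOnCl hC
  rw [iteratedDeriv_hermiteGen_zero, ← ofReal_aeval_hermite, Complex.norm_real,
    Real.norm_eq_abs] at hcauchy
  have hpi : Real.pi ^ (-(1 / 4) : ℝ) ≤ 1 :=
    Real.rpow_le_one_of_one_le_of_nonpos (by linarith [Real.pi_gt_three]) (by norm_num)
  have hfac : (0 : ℝ) < Real.sqrt n.factorial := by positivity
  have hsqrt : (n.factorial : ℝ) = Real.sqrt n.factorial * Real.sqrt n.factorial :=
    (Real.mul_self_sqrt (by positivity)).symm
  have hst := sqrt_factorial_mul_exp_le n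
  rw [← hr, ← hr2] at hst
  rw [hermiteFun, abs_mul, abs_mul, abs_mul, abs_of_nonneg (by positivity : 0 ≤ Real.pi ^ (-(1 / 4) : ℝ)),
    abs_of_nonneg (by positivity : 0 ≤ (Real.sqrt n.factorial)⁻¹), Real.abs_exp]
  have hA : |Polynomial.aeval y (Polynomial.hermite n)| * ((1 + t ^ 2) * Real.exp (-t ^ 2 / 2))
      * (Real.sqrt n.factorial)⁻¹ ≤ 4 * (1 + 4 * r ^ 2) * (Real.exp 1 * r ^ 2) := by
    calc _ ≤ (n.factorial * (4 * (1 + 4 * r ^ 2) * Real.exp (r ^ 2 / 2) /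
            ((1 + t ^ 2) * Real.exp (-t ^ 2 / 2))) / r ^ n) *
            ((1 + t ^ 2) * Real.exp (-t ^ 2 / 2)) * (Real.sqrt n.factorial)⁻¹ := by gcongr
      _ = 4 * (1 + 4 * r ^ 2) * (Real.sqrt n.factorial * Real.exp (r ^ 2 / 2)) / r ^ n := by
          rw [hsqrt]
          field_simp
          rw [Real.sqrt_sq (Real.sqrt_nonneg _)]
      _ ≤ 4 * (1 + 4 * r ^ 2) * (Real.exp 1 * r ^ 2 * r ^ n) / r ^ n := by gcongr
      _ = _ := by field_simp
  calc (1 + t ^ 2) * (Real.pi ^ (-(1 / 4) : ℝ) * (Real.sqrt n.factorial)⁻¹ *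
        |Polynomial.aeval y (Polynomial.hermite n)| * Real.exp (-t ^ 2 / 2))
      = Real.pi ^ (-(1 / 4) : ℝ) * (|Polynomial.aeval y (Polynomial.hermite n)| *
          ((1 + t ^ 2) * Real.exp (-t ^ 2 / 2)) * (Real.sqrt n.factorial)⁻¹) := by ring
    _ ≤ 1 * (4 * (1 + 4 * r ^ 2) * (Real.exp 1 * r ^ 2)) := by gcongr
    _ ≤ 64 * ((n : ℝ) + 1) ^ 2 := by
        rw [hr2]
        -- With `e ≤ 3` the left side is at most `4 · 5 · 3 (n + 1)² = 60 (n + 1)²`.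
        have he : Real.exp 1 ≤ 3 := by linarith [Real.exp_one_lt_d9]
        have hn : (0 : ℝ) ≤ n := n.cast_nonneg
        nlinarith [mul_le_mul_of_nonneg_right he
          (by positivity : 0 ≤ ((n : ℝ) + 1) * (4 * (1 + 4 * ((n : ℝ) + 1))))]

/-- The creation operator `t - d/dt` raises the degree of a Hermite function. -/
theorem hasDerivAt_hermiteFun (n : ℕ) (t : ℝ) :
    HasDerivAt (hermiteFun n)
      (t * hermiteFun n t - Real.sqrt (2 * (n + 1)) * hermiteFun (n + 1) t) t := by
  have h1 : HasDerivAt (fun t : ℝ => Polynomial.aeval (Real.sqrt 2 * t) (Polynomial.hermite n))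
      (Polynomial.aeval (Real.sqrt 2 * t) (Polynomial.derivative (Polynomial.hermite n)) *
        Real.sqrt 2) t := by
    exact (((Polynomial.hermite n).hasDerivAt_aeval (Real.sqrt 2 * t)).comp t
      ((hasDerivAt_id' t).const_mul (Real.sqrt 2))).congr_deriv (by simp)
  have h2 : HasDerivAt (fun t : ℝ => Real.exp (-(t ^ 2) / 2)) (-t * Real.exp (-(t ^ 2) / 2)) t := by
    exact (((((hasDerivAt_id' t).fun_pow 2).fun_neg).div_const 2).exp).congr_deriv
      (by simp; ring)
  have h := ((h1.const_mul (Real.pi ^ (-(1 / 4) : ℝ) * (Real.sqrt (n.factorial : ℝ))⁻¹)).mul h2)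
  refine h.congr_deriv ?_
  have hf : Real.sqrt ((n + 1).factorial : ℝ) = Real.sqrt (n + 1) * Real.sqrt n.factorial := by
    rw [Nat.factorial_succ]
    push_cast
    rw [Real.sqrt_mul (by positivity)]
  have h22 : Real.sqrt 2 * Real.sqrt 2 = 2 := Real.mul_self_sqrt (by norm_num)
  simp only [hermiteFun]
  rw [Real.sqrt_mul (by norm_num), hf, Polynomial.hermite_succ]
  simp only [map_sub, map_mul, Polynomial.aeval_X]
  have hn : Real.sqrt ((n : ℝ) + 1) ≠ 0 := by positivity
  have hn' : Real.sqrt (n.factorial : ℝ) ≠ 0 := by positivity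
  field_simp
  linear_combination ((t * Polynomial.aeval (Real.sqrt 2 * t) (Polynomial.hermite n))) * h22

theorem derivative_hermite_succ (n : ℕ) :
    Polynomial.derivative (Polynomial.hermite (n + 1)) =
      ((n : ℕ) + 1 : Polynomial ℤ) * Polynomial.hermite n := by
  induction n with
  | zero => simp
  | succ n ih =>
    rw [Polynomial.hermite_succ (n + 1), Polynomial.derivative_sub, Polynomial.derivative_mul, ih]
    simp only [Polynomial.derivative_X, Polynomial.derivative_mul, Polynomial.derivative_add,
      Polynomial.derivative_natCast, Polynomial.derivative_one]
    rw [Polynomial.hermite_succ n]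
    push_cast
    ring

/-- The annihilation operator `t + d/dt` lowers the degree of a Hermite function. -/
theorem hasDerivAt_hermiteFun_succ (n : ℕ) (t : ℝ) :
    HasDerivAt (hermiteFun (n + 1))
      (Real.sqrt (2 * (n + 1)) * hermiteFun n t - t * hermiteFun (n + 1) t) t := by
  have h1 : HasDerivAt
      (fun t : ℝ => Polynomial.aeval (Real.sqrt 2 * t) (Polynomial.hermite (n + 1)))
      (Polynomial.aeval (Real.sqrt 2 * t) (Polynomial.derivative (Polynomial.hermite (n + 1))) *
        Real.sqrt 2) t := by
    exact (((Polynomial.hermite (n + 1)).hasDerivAt_aeval (Real.sqrt 2 * t)).comp t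
      ((hasDerivAt_id' t).const_mul (Real.sqrt 2))).congr_deriv (by simp)
  have h2 : HasDerivAt (fun t : ℝ => Real.exp (-(t ^ 2) / 2)) (-t * Real.exp (-(t ^ 2) / 2)) t := by
    exact (((((hasDerivAt_id' t).fun_pow 2).fun_neg).div_const 2).exp).congr_deriv
      (by simp; ring)
  have h := ((h1.const_mul
    (Real.pi ^ (-(1 / 4) : ℝ) * (Real.sqrt ((n + 1).factorial : ℝ))⁻¹)).mul h2)
  refine h.congr_deriv ?_
  have hf : Real.sqrt ((n + 1).factorial : ℝ) = Real.sqrt (n + 1) * Real.sqrt n.factorial := by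
    rw [Nat.factorial_succ]
    push_cast
    rw [Real.sqrt_mul (by positivity)]
  have hn2 : Real.sqrt ((n : ℝ) + 1) * Real.sqrt ((n : ℝ) + 1) = n + 1 :=
    Real.mul_self_sqrt (by positivity)
  simp only [hermiteFun]
  rw [Real.sqrt_mul (by norm_num), hf, derivative_hermite_succ]
  simp only [map_mul, map_add, map_natCast, map_one]
  have hn : Real.sqrt ((n : ℝ) + 1) ≠ 0 := by positivity
  have hn' : Real.sqrt (n.factorial : ℝ) ≠ 0 := by positivity
  field_simp
  linear_combination (-(Real.sqrt 2 * Polynomial.aeval (Real.sqrt 2 * t) (Polynomial.hermite n))) * hn2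

end PilipovicSpaces

namespace PilipovicSpaces

/-! ### Series over multi-indices -/

theorem hasSum_mul_of_summable_norm {𝕜 ι κ : Type*} [NormedField 𝕜] [CompleteSpace 𝕜]
    {f : ι → 𝕜} {g : κ → 𝕜} {a b : 𝕜} (hf : HasSum f a) (hg : HasSum g b)
    (hfn : Summable fun n => ‖f n‖) (hgn : Summable fun n => ‖g n‖) :
    HasSum (fun p : ι × κ => f p.1 * g p.2) (a * b) :=
  hf.mul hg (summable_mul_of_summable_norm hfn hgn)

/-- The two conclusions go together: the induction splits off coordinate `0` and multiplies two
series, which requires absolute convergence over the remaining coordinates. -/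
theorem hasSum_prod_multiIndex_and_summable_norm {𝕜 : Type*} [NormedField 𝕜] [CompleteSpace 𝕜]
    {d : ℕ} {f : Fin d → ℕ → 𝕜} {a : Fin d → 𝕜} (h : ∀ i, HasSum (f i) (a i))
    (hn : ∀ i, Summable fun n => ‖f i n‖) :
    HasSum (fun α : MultiIndex d => ∏ i, f i (α i)) (∏ i, a i) ∧
      Summable fun α : MultiIndex d => ‖∏ i, f i (α i)‖ := by
  induction d with
  | zero =>
    have : Unique (MultiIndex 0) := Pi.uniqueOfIsEmpty _
    have h1 := hasSum_unique (fun _ : MultiIndex 0 => (1 : 𝕜))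
    have h2 := (hasSum_unique (fun _ : MultiIndex 0 => (1 : ℝ))).summable
    simpa only [Finset.univ_eq_empty, Finset.prod_empty, norm_one] using And.intro h1 h2
  | succ d ih =>
    obtain ⟨h1, h1n⟩ := ih (f := fun i => f i.succ) (a := fun i => a i.succ) (fun i => h i.succ)
      fun i => hn i.succ
    have h2 := hasSum_mul_of_summable_norm (h 0) h1 (hn 0) h1n
    have h2n := (hn 0).mul_norm h1n
    rw [Fin.prod_univ_succ, ← (Fin.consEquiv fun _ : Fin (d + 1) => ℕ).hasSum_iff,
      ← (Fin.consEquiv fun _ : Fin (d + 1) => ℕ).summable_iff]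
    refine ⟨h2.congr_fun fun p => ?_, h2n.congr fun p => ?_⟩ <;>
      simp [Fin.prod_univ_succ, Fin.consEquiv]

theorem hasSum_prod_multiIndex {d : ℕ} {f : Fin d → ℕ → ℂ} {a : Fin d → ℂ}
    (h : ∀ i, HasSum (f i) (a i)) :
    HasSum (fun α : MultiIndex d => ∏ i, f i (α i)) (∏ i, a i) :=
  (hasSum_prod_multiIndex_and_summable_norm h fun i => (h i).summable.norm).1

theorem summable_prod_multiIndex {d : ℕ} {f : Fin d → ℕ → ℝ}
    (h : ∀ i, Summable (f i)) : Summable fun α : MultiIndex d => ∏ i, f i (α i) :=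
  (hasSum_prod_multiIndex_and_summable_norm (fun i => (h i).hasSum) fun i => (h i).norm).1.summable

theorem MultiIndex.le_length {d : ℕ} (α : MultiIndex d) (i : Fin d) : α i ≤ α.length :=
  Finset.single_le_sum (f := α) (fun _ _ => Nat.zero_le _) (Finset.mem_univ i)

theorem MultiIndex.prod_le_one_add_length_pow {d : ℕ} (α : MultiIndex d) (k : ℕ) :
    ∏ i, ((α i : ℝ) + 1) ^ k ≤ (1 + (α.length : ℝ)) ^ (k * d) := by
  calc ∏ i, ((α i : ℝ) + 1) ^ k ≤ ∏ _i : Fin d, (1 + (α.length : ℝ)) ^ k := by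
        refine Finset.prod_le_prod (fun i _ => by positivity) fun i _ => ?_
        have : (α i : ℝ) ≤ α.length := by exact_mod_cast α.le_length i
        exact pow_le_pow_left₀ (by positivity) (by linarith) k
    _ = _ := by simp [pow_mul]

/-- Comparison with the product of `d` copies of `∑ (n + 1)^(-2)`. Whenever a series over
multi-indices has to converge at the end, `2 * d` spare powers of `1 + |α|` are spent on this
weight. -/
theorem summable_one_add_length_pow (d : ℕ) :
    Summable fun α : MultiIndex d => ((1 + (α.length : ℝ)) ^ (2 * d))⁻¹ := by
  have h1 : Summable fun n : ℕ => (((n : ℝ) + 1) ^ 2)⁻¹ := by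
    have := (summable_nat_add_iff 1).2 (Real.summable_nat_pow_inv.2 (one_lt_two))
    simpa using this
  refine Summable.of_nonneg_of_le (fun α => by positivity) (fun α => ?_)
    (summable_prod_multiIndex (d := d) fun _ => h1)
  rw [Finset.prod_inv_distrib]
  exact inv_anti₀ (Finset.prod_pos fun i _ => by positivity) (α.prod_le_one_add_length_pow 2)

/-! ### Cauchy estimates on a torus -/

theorem integral_fourier (n : ℤ) :
    ∫ t : AddCircle (1 : ℝ), fourier n t ∂AddCircle.haarAddCircle = if n = 0 then 1 else 0 := by
  have := (orthonormal_iff_ite.mp (orthonormal_fourier (T := 1))) 0 n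
  simp only [MeasureTheory.ContinuousMap.inner_toLp, ← fourier_neg, ← fourier_add] at this
  simpa [eq_comm] using this

theorem integral_prod_fourier {d : ℕ} (n : Fin d → ℤ) :
    ∫ t : Fin d → AddCircle (1 : ℝ), ∏ i, (fourier (n i) (t i) : ℂ)
      ∂MeasureTheory.Measure.pi (fun _ => AddCircle.haarAddCircle) = if n = 0 then 1 else 0 := by
  rw [MeasureTheory.integral_fintype_prod_eq_prod (fun i (t : AddCircle (1 : ℝ)) =>
    (fourier (n i) t : ℂ))]
  simp only [integral_fourier]
  split_ifs with h
  · simp [h]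
  · obtain ⟨i, hi⟩ := Function.ne_iff.mp h
    exact Finset.prod_eq_zero (Finset.mem_univ i) (if_neg hi)

/-- Cauchy's estimate for the coefficients of an absolutely convergent power series in `d`
variables which is bounded on a torus. -/
theorem norm_coeff_mul_le_of_torus {d : ℕ} (a : MultiIndex d → ℂ) (R : Fin d → ℝ)
    (hR : ∀ i, 0 ≤ R i) (hs : Summable fun α : MultiIndex d => ‖a α‖ * ∏ i, R i ^ α i) (M : ℝ)
    (hM : ∀ ζ : Fin d → ℂ, (∀ i, ‖ζ i‖ = R i) → ‖∑' α, a α * ∏ i, ζ i ^ α i‖ ≤ M)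
    (β : MultiIndex d) : ‖a β‖ * ∏ i, R i ^ β i ≤ M := by
  let μ : MeasureTheory.Measure (Fin d → AddCircle (1 : ℝ)) :=
    MeasureTheory.Measure.pi (fun _ => AddCircle.haarAddCircle)
  -- The `α`-th term of the series on the torus, times the character of frequency `-β`; integration
  -- then keeps only `α = β`.
  let F : MultiIndex d → (Fin d → AddCircle (1 : ℝ)) → ℂ := fun α t =>
    a α * (∏ i, (R i : ℂ) ^ α i) * ∏ i, (fourier ((α i : ℤ) - β i) (t i) : ℂ)
  have hnorm : ∀ α t, ‖F α t‖ = ‖a α‖ * ∏ i, R i ^ α i := fun α t => by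
    have h1 : ∀ i, ‖(fourier ((α i : ℤ) - β i) (t i) : ℂ)‖ = 1 := fun i => by
      simp only [fourier_apply, Circle.norm_coe]
    simp only [F, norm_mul, norm_prod, h1, norm_pow, Complex.norm_real, Finset.prod_const_one,
      mul_one]
    congr 1
    exact Finset.prod_congr rfl fun i _ => by rw [Real.norm_of_nonneg (hR i)]
  have hcont : ∀ α, Continuous (F α) := fun α => by
    refine continuous_const.mul (continuous_finsetProd _ fun i _ => ?_)
    exact (fourier _).continuous.comp (continuous_apply i)
  have hint : ∀ α, MeasureTheory.Integrable (F α) μ := fun α =>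
    MeasureTheory.Integrable.of_bound (hcont α).aestronglyMeasurable (‖a α‖ * ∏ i, R i ^ α i)
      (.of_forall fun t => (hnorm α t).le)
  have hsum := MeasureTheory.hasSum_integral_of_summable_integral_norm hint (by
    simpa only [hnorm, MeasureTheory.integral_const, MeasureTheory.probReal_univ, one_smul]
      using hs)
  have hcoef : ∀ α, ∫ t, F α t ∂μ = if α = β then a β * ∏ i, (R i : ℂ) ^ β i else 0 := fun α => by
    simp only [F, MeasureTheory.integral_const_mul]
    rw [integral_prod_fourier (fun i => (α i : ℤ) - β i)]
    by_cases h : α = β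
    · subst h
      simp [funext_iff]
    · have : (fun i => (α i : ℤ) - β i) ≠ 0 := fun h0 => h <| funext fun i => by
        have := congrFun h0 i
        simp only [Pi.zero_apply] at this
        omega
      simp [h, this]
  have hval : ∫ t, ∑' α, F α t ∂μ = a β * ∏ i, (R i : ℂ) ^ β i := by
    rw [← hsum.tsum_eq]
    simp only [hcoef]
    exact tsum_ite_eq β _
  have hbound : ∀ t, ‖∑' α, F α t‖ ≤ M := fun t => by
    let ζ : Fin d → ℂ := fun i => R i * fourier 1 (t i)
    have hζ : ∀ i, ‖ζ i‖ = R i := fun i => by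
      simp only [ζ, norm_mul, Complex.norm_real, fourier_apply, Circle.norm_coe, mul_one,
        Real.norm_of_nonneg (hR i)]
    have hF : ∀ α, F α t = (∏ i, (fourier (-(β i : ℤ)) (t i) : ℂ)) * (a α * ∏ i, ζ i ^ α i) :=
      fun α => by
        have h1 : ∀ i, (fourier ((α i : ℤ) - β i) (t i) : ℂ) =
            fourier (-(β i : ℤ)) (t i) * fourier 1 (t i) ^ α i := fun i => by
          rw [sub_eq_neg_add, fourier_add]
          congr 1
          simp [fourier_apply, AddCircle.toCircle_nsmul]
        simp only [F, ζ, h1, mul_pow, Finset.prod_mul_distrib]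
        ring
    simp only [hF, tsum_mul_left, norm_mul, norm_prod]
    have h1 : ∀ i, ‖(fourier (-(β i : ℤ)) (t i) : ℂ)‖ = 1 := fun i => by
      simp only [fourier_apply, Circle.norm_coe]
    simp only [h1, Finset.prod_const_one, one_mul]
    exact hM ζ hζ
  calc ‖a β‖ * ∏ i, R i ^ β i = ‖a β * ∏ i, (R i : ℂ) ^ β i‖ := by
        rw [norm_mul, norm_prod]
        congr 1
        exact Finset.prod_congr rfl fun i _ => by
          rw [norm_pow, Complex.norm_real, Real.norm_of_nonneg (hR i)]
    _ = ‖∫ t, ∑' α, F α t ∂μ‖ := by rw [hval]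
    _ ≤ M := by
        simpa using MeasureTheory.norm_integral_le_of_norm_le_const (μ := μ) (.of_forall hbound)

end PilipovicSpaces

namespace PilipovicSpaces

open SchwartzMap

/-! ### Gaussians as Schwartz functions -/

@[fun_prop]
theorem hasTemperateGrowth_coord {d : ℕ} (j : Fin d) :
    Function.HasTemperateGrowth fun x : Space d => x j :=
  (EuclideanSpace.proj j : Space d →L[ℝ] ℝ).hasTemperateGrowth

theorem hasTemperateGrowth_ofReal_coord {d : ℕ} (j : Fin d) :
    Function.HasTemperateGrowth fun x : Space d => (x j : ℂ) :=
  Function.HasTemperateGrowth.comp Complex.ofRealCLM.hasTemperateGrowth (hasTemperateGrowth_coord j)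

/-- The exponent `w · y - |y|²/2`. -/
noncomputable def gaussianExponent {d : ℕ} (w : Fin d → ℂ) (y : Space d) : ℂ :=
  ∑ i, (w i * (y i : ℂ) - (y i : ℂ) ^ 2 / 2)

theorem hasTemperateGrowth_gaussianExponent {d : ℕ} (w : Fin d → ℂ) :
    Function.HasTemperateGrowth (gaussianExponent w) := by
  refine Function.HasTemperateGrowth.sum fun i _ => ?_
  have h := hasTemperateGrowth_ofReal_coord i
  have h2 := (Function.HasTemperateGrowth.const (2 : ℂ)⁻¹ (E := Space d)).mul (h.pow 2)
  have := ((Function.HasTemperateGrowth.const (w i) (E := Space d)).mul h).sub h2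
  convert! this using 1
  ext y
  simp
  ring

/-- All derivatives of `exp` have the size of `exp` itself, so the Faà di Bruno estimate for the
Gaussian retains the full Gaussian decay. -/
theorem norm_iteratedFDeriv_cexp (n : ℕ) (z : ℂ) :
    ‖iteratedFDeriv ℝ n Complex.exp z‖ = ‖Complex.exp z‖ := by
  have h := (ContDiffAt.restrictScalars_iteratedFDeriv_eventuallyEq (𝕜 := ℝ) (n := n)
    (Complex.contDiff_exp (𝕜 := ℂ) (n := n)).contDiffAt (x := z)).self_of_nhds
  rw [← h, Function.comp_apply, ContinuousMultilinearMap.norm_restrictScalars,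
    norm_iteratedFDeriv_eq_norm_iteratedDeriv]
  have := congrFun (iteratedDeriv_cexp_const_mul n 1) z
  simp only [one_mul, one_pow] at this
  rw [this]

theorem re_gaussianExponent {d : ℕ} (w : Fin d → ℂ) (y : Space d) :
    (gaussianExponent w y).re = ∑ i, ((w i).re * y i - y i ^ 2 / 2) := by
  simp only [gaussianExponent, Complex.re_sum]
  refine Finset.sum_congr rfl fun i _ => ?_
  simp [pow_two]

theorem re_gaussianExponent_le {d : ℕ} (w : Fin d → ℂ) (y : Space d) :
    (gaussianExponent w y).re ≤ (∑ i, ‖w i‖) * ‖y‖ - ‖y‖ ^ 2 / 2 := by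
  rw [re_gaussianExponent, Finset.sum_sub_distrib, ← Finset.sum_div, EuclideanSpace.norm_sq_eq]
  simp only [Real.norm_eq_abs, sq_abs]
  gcongr
  rw [Finset.sum_mul]
  refine Finset.sum_le_sum fun i _ => ?_
  calc (w i).re * y i ≤ |(w i).re| * |y i| := by
        rw [← abs_mul]
        exact le_abs_self _
    _ ≤ ‖w i‖ * ‖y‖ := by
        gcongr
        · exact Complex.abs_re_le_norm _
        · exact PiLp.norm_apply_le y i

theorem one_add_pow_mul_exp_le (A r : ℝ) (hr : 0 ≤ r) (m : ℕ) :
    (1 + r) ^ m * Real.exp (A * r - r ^ 2 / 2) ≤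
      m.factorial * Real.exp (1 + (A + 1) ^ 2 / 2) := by
  have h1 : (1 + r) ^ m ≤ m.factorial * Real.exp (1 + r) := by
    have := Real.pow_div_factorial_le_exp (1 + r) (by linarith) m
    rwa [div_le_iff₀ (by positivity), mul_comm] at this
  calc (1 + r) ^ m * Real.exp (A * r - r ^ 2 / 2)
      ≤ m.factorial * Real.exp (1 + r) * Real.exp (A * r - r ^ 2 / 2) := by gcongr
    _ = m.factorial * Real.exp (1 + r + (A * r - r ^ 2 / 2)) := by
        rw [Real.exp_add (1 + r)]
        ring
    _ ≤ _ := by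
        refine mul_le_mul_of_nonneg_left (Real.exp_le_exp.2 ?_) (by positivity)
        nlinarith [sq_nonneg (r - (A + 1))]

/-- The Gaussian `y ↦ exp(w · y - |y|²/2)`, `w ∈ ℂᵈ`, as a Schwartz function. -/
noncomputable def gaussian {d : ℕ} (w : Fin d → ℂ) : 𝓢(Space d, ℂ) where
  toFun y := Complex.exp (gaussianExponent w y)
  smooth' := Complex.contDiff_exp.comp (hasTemperateGrowth_gaussianExponent w).1
  decay' k n := by
    obtain ⟨l, C, hC0, hC⟩ := (hasTemperateGrowth_gaussianExponent w).norm_iteratedFDeriv_le_uniform n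
    set A : ℝ := ∑ i, ‖w i‖
    refine ⟨n.factorial * (1 + C) ^ n * ((k + l * n).factorial * Real.exp (1 + (A + 1) ^ 2 / 2)),
      fun y => ?_⟩
    have h1 := norm_iteratedFDeriv_comp_le (𝕜 := ℝ) (n := n) (N := n)
      (g := Complex.exp) (f := gaussianExponent w) (Complex.contDiff_exp (𝕜 := ℝ))
      ((hasTemperateGrowth_gaussianExponent w).1.of_le (by exact_mod_cast le_top)) le_rfl y
      (C := ‖Complex.exp (gaussianExponent w y)‖) (D := (1 + C) * (1 + ‖y‖) ^ l)
      (fun i _ => (norm_iteratedFDeriv_cexp i _).le) (fun i hi hin => by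
        -- The `i`-th derivative must be bounded by the `i`-th power of one number `D`; since `i ≥
        -- 1` and `D ≥ 1`, a bound by `D` suffices.
        have hD : 1 ≤ (1 + C) * (1 + ‖y‖) ^ l := one_le_mul_of_one_le_of_one_le (by linarith)
          (one_le_pow₀ (by linarith [norm_nonneg y]))
        refine (hC i hin y).trans (le_trans ?_ (le_self_pow₀ hD (by omega)))
        gcongr
        linarith)
    have h2 : ‖Complex.exp (gaussianExponent w y)‖ ≤ Real.exp (A * ‖y‖ - ‖y‖ ^ 2 / 2) := by
      rw [Complex.norm_exp]
      exact Real.exp_le_exp.2 (re_gaussianExponent_le w y)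
    have h3 := one_add_pow_mul_exp_le A ‖y‖ (norm_nonneg y) (k + l * n)
    calc ‖y‖ ^ k * ‖iteratedFDeriv ℝ n (Complex.exp ∘ gaussianExponent w) y‖
        ≤ (1 + ‖y‖) ^ k * (n.factorial * Real.exp (A * ‖y‖ - ‖y‖ ^ 2 / 2) *
            ((1 + C) * (1 + ‖y‖) ^ l) ^ n) := by
          gcongr
          · linarith
          · refine h1.trans ?_
            gcongr
      _ = n.factorial * (1 + C) ^ n *
            ((1 + ‖y‖) ^ (k + l * n) * Real.exp (A * ‖y‖ - ‖y‖ ^ 2 / 2)) := by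
          rw [mul_pow, pow_add, pow_mul]
          ring
      _ ≤ _ := by gcongr

theorem gaussian_apply {d : ℕ} (w : Fin d → ℂ) (y : Space d) :
    gaussian w y = Complex.exp (gaussianExponent w y) := rfl

theorem gaussian_apply_eq_prod {d : ℕ} (w : Fin d → ℂ) (y : Space d) :
    gaussian w y = ∏ i, Complex.exp (w i * (y i : ℂ) - (y i : ℂ) ^ 2 / 2) := by
  rw [gaussian_apply, gaussianExponent, Complex.exp_sum]

/-! ### Hermite functions as Schwartz functions -/

/-- The polynomial factor of a Hermite function. -/
noncomputable def hermitePolyFactor {d : ℕ} (α : MultiIndex d) (x : Space d) : ℂ :=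
  ∏ i, ((Real.pi ^ (-(1 / 4) : ℝ) * (Real.sqrt ((α i).factorial : ℝ))⁻¹ : ℝ) : ℂ) *
    Polynomial.aeval ((Real.sqrt 2 * x i : ℝ) : ℂ) (Polynomial.hermite (α i))

theorem hasTemperateGrowth_aeval {E : Type*} [NormedAddCommGroup E] [NormedSpace ℝ E]
    {f : E → ℂ} (hf : Function.HasTemperateGrowth f) (p : Polynomial ℤ) :
    Function.HasTemperateGrowth fun x => Polynomial.aeval (f x) p := by
  induction p using Polynomial.induction_on' with
  | add p q hp hq => simpa using! hp.add hq
  | monomial n a =>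
    simpa using! (Function.HasTemperateGrowth.const (a : ℂ) (E := E)).mul (hf.pow n)

theorem hasTemperateGrowth_finsetProd {E ι : Type*} [NormedAddCommGroup E] [NormedSpace ℝ E]
    {f : ι → E → ℂ} (s : Finset ι) (hf : ∀ i ∈ s, Function.HasTemperateGrowth (f i)) :
    Function.HasTemperateGrowth fun x => ∏ i ∈ s, f i x := by
  classical
  induction s using Finset.induction_on with
  | empty => simp
  | insert a s ha ih =>
    simp only [Finset.prod_insert ha]
    exact (hf a (Finset.mem_insert_self a s)).mul
      (ih fun i hi => hf i (Finset.mem_insert_of_mem hi))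

theorem hasTemperateGrowth_hermitePolyFactor {d : ℕ} (α : MultiIndex d) :
    Function.HasTemperateGrowth (hermitePolyFactor α) := by
  refine hasTemperateGrowth_finsetProd _ fun i _ => ?_
  refine (Function.HasTemperateGrowth.const _).mul (hasTemperateGrowth_aeval ?_ _)
  have := (Function.HasTemperateGrowth.const (Real.sqrt 2 : ℂ) (E := Space d)).mul
    (hasTemperateGrowth_ofReal_coord i)
  convert! this using 1
  ext x
  simp

/-- The Hermite function `h_α` as a Schwartz function. -/
noncomputable def hermiteSchwartz {d : ℕ} (α : MultiIndex d) : 𝓢(Space d, ℂ) :=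
  smulLeftCLM ℂ (hermitePolyFactor α) (gaussian 0)

theorem hermiteSchwartz_apply {d : ℕ} (α : MultiIndex d) (x : Space d) :
    hermiteSchwartz α x = (hermiteFn α x : ℂ) := by
  rw [hermiteSchwartz, smulLeftCLM_apply_apply (hasTemperateGrowth_hermitePolyFactor α),
    gaussian_apply_eq_prod, hermitePolyFactor, smul_eq_mul, ← Finset.prod_mul_distrib, hermiteFn,
    Complex.ofReal_prod]
  refine Finset.prod_congr rfl fun i _ => ?_
  rw [hermiteFun, Complex.ofReal_mul _ (Real.exp _), Complex.ofReal_mul _ (Polynomial.aeval _ _),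
    ofReal_aeval_hermite, Complex.ofReal_exp]
  congr 2
  push_cast
  simp only [Pi.zero_apply]
  ring

/-! ### Coordinate multiplications and derivatives -/

/-- Multiplication by the `j`-th coordinate. -/
noncomputable def mulCoord {d : ℕ} (j : Fin d) : 𝓢(Space d, ℂ) →L[ℂ] 𝓢(Space d, ℂ) :=
  smulLeftCLM ℂ fun x : Space d => (x j : ℂ)

/-- The partial derivative in the `j`-th coordinate. -/
noncomputable def derivCoord {d : ℕ} (j : Fin d) : 𝓢(Space d, ℂ) →L[ℂ] 𝓢(Space d, ℂ) :=
  LineDeriv.lineDerivOpCLM ℂ 𝓢(Space d, ℂ) (EuclideanSpace.single j (1 : ℝ))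

theorem mulCoord_apply {d : ℕ} (j : Fin d) (ψ : 𝓢(Space d, ℂ)) (x : Space d) :
    mulCoord j ψ x = x j * ψ x :=
  smulLeftCLM_apply_apply (hasTemperateGrowth_ofReal_coord j) ψ x

theorem derivCoord_apply {d : ℕ} (j : Fin d) (ψ : 𝓢(Space d, ℂ)) (x : Space d) :
    derivCoord j ψ x = lineDeriv ℝ ψ x (EuclideanSpace.single j 1) := by
  rw [derivCoord, LineDeriv.lineDerivOpCLM_apply, lineDerivOp_apply]

theorem prod_update_eq {d : ℕ} (g : Fin d → ℝ → ℂ) (j : Fin d) (c : ℝ → ℂ) (x : Space d) :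
    ∏ i, Function.update g j c i (x i) = c (x j) * ∏ i ∈ Finset.univ.erase j, g i (x i) := by
  rw [← Finset.mul_prod_erase _ _ (Finset.mem_univ j)]
  congr 1
  · simp
  · refine Finset.prod_congr rfl fun i hi => ?_
    simp [Finset.ne_of_mem_erase hi]

/-- The partial derivative of a product of functions of the separate coordinates. -/
theorem lineDeriv_prod {d : ℕ} (g : Fin d → ℝ → ℂ) (j : Fin d) {g' : ℝ → ℂ}
    (hg : ∀ t, HasDerivAt (g j) (g' t) t) (x : Space d) :
    lineDeriv ℝ (fun y : Space d => ∏ i, g i (y i)) x (EuclideanSpace.single j 1) =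
      ∏ i, Function.update g j g' i (x i) := by
  have h1 : ∀ t : ℝ, ∏ i, g i ((x + t • EuclideanSpace.single j (1 : ℝ)) i) =
      g j (x j + t) * ∏ i ∈ Finset.univ.erase j, g i (x i) := fun t => by
    rw [← Finset.mul_prod_erase _ _ (Finset.mem_univ j)]
    congr 1
    · simp
    · refine Finset.prod_congr rfl fun i hi => ?_
      simp [Finset.ne_of_mem_erase hi]
  have h2 : HasLineDerivAt ℝ (fun y : Space d => ∏ i, g i (y i))
      (g' (x j) * ∏ i ∈ Finset.univ.erase j, g i (x i)) x (EuclideanSpace.single j 1) := by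
    rw [HasLineDerivAt, funext h1]
    refine HasDerivAt.mul_const ?_ _
    exact HasDerivAt.comp_const_add (x j) 0 (by simpa using hg (x j))
  rw [h2.lineDeriv, prod_update_eq]

theorem derivCoord_apply_of_eq_prod {d : ℕ} {ψ : 𝓢(Space d, ℂ)} {g : Fin d → ℝ → ℂ}
    (hψ : ∀ y, ψ y = ∏ i, g i (y i)) (j : Fin d) {g' : ℝ → ℂ}
    (hg : ∀ t, HasDerivAt (g j) (g' t) t) (x : Space d) :
    derivCoord j ψ x = ∏ i, Function.update g j g' i (x i) := by
  rw [derivCoord_apply, ← lineDeriv_prod g j hg]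
  congr 1
  exact funext hψ

theorem hermiteSchwartz_eq_prod {d : ℕ} (α : MultiIndex d) (y : Space d) :
    hermiteSchwartz α y = ∏ i, (hermiteFun (α i) (y i) : ℂ) := by
  rw [hermiteSchwartz_apply, hermiteFn, Complex.ofReal_prod]

theorem hermiteSchwartz_add_single_apply {d : ℕ} (α : MultiIndex d) (j : Fin d) (x : Space d) :
    hermiteSchwartz (α + Pi.single j 1) x = (hermiteFun (α j + 1) (x j) : ℂ) *
      ∏ i ∈ Finset.univ.erase j, (hermiteFun (α i) (x i) : ℂ) := by
  rw [hermiteSchwartz_eq_prod, ← Finset.mul_prod_erase _ _ (Finset.mem_univ j)]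
  congr 1
  · simp
  · refine Finset.prod_congr rfl fun i hi => ?_
    simp [Finset.ne_of_mem_erase hi]

/-- The creation operator acting on Hermite functions. -/
theorem derivCoord_hermiteSchwartz {d : ℕ} (α : MultiIndex d) (j : Fin d) :
    derivCoord j (hermiteSchwartz α) = mulCoord j (hermiteSchwartz α) -
      (Real.sqrt (2 * (α j + 1)) : ℂ) • hermiteSchwartz (α + Pi.single j 1) := by
  ext x
  rw [sub_apply, smul_apply, mulCoord_apply, hermiteSchwartz_add_single_apply,
    derivCoord_apply_of_eq_prod (g := fun i t => (hermiteFun (α i) t : ℂ))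
      (hermiteSchwartz_eq_prod α) j (fun t => (hasDerivAt_hermiteFun (α j) t).ofReal_comp),
    hermiteSchwartz_eq_prod, prod_update_eq, smul_eq_mul, ← Finset.mul_prod_erase _ _ (Finset.mem_univ j)]
  push_cast
  ring

/-- The annihilation operator acting on Hermite functions. -/
theorem derivCoord_hermiteSchwartz_add_single {d : ℕ} (α : MultiIndex d) (j : Fin d) :
    derivCoord j (hermiteSchwartz (α + Pi.single j 1)) =
      (Real.sqrt (2 * (α j + 1)) : ℂ) • hermiteSchwartz α -
        mulCoord j (hermiteSchwartz (α + Pi.single j 1)) := by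
  obtain ⟨β, hβ⟩ : ∃ β : MultiIndex d, β = α + Pi.single j 1 := ⟨_, rfl⟩
  have hj : β j = α j + 1 := by simp [hβ]
  have hi : ∀ i ∈ Finset.univ.erase j, β i = α i := fun i hi => by
    simp [hβ, Finset.ne_of_mem_erase hi]
  rw [← hβ]
  ext x
  have hg : ∀ t, HasDerivAt (fun t => (hermiteFun (β j) t : ℂ))
      ((Real.sqrt (2 * (α j + 1)) * hermiteFun (α j) t - t * hermiteFun (α j + 1) t : ℝ) : ℂ) t :=
    fun t => by
      rw [hj]
      exact (hasDerivAt_hermiteFun_succ (α j) t).ofReal_comp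
  have h : ∏ i ∈ Finset.univ.erase j, (hermiteFun (β i) (x i) : ℂ) =
      ∏ i ∈ Finset.univ.erase j, (hermiteFun (α i) (x i) : ℂ) :=
    Finset.prod_congr rfl fun i h => by rw [hi i h]
  have h1 := derivCoord_apply_of_eq_prod (g := fun i t => (hermiteFun (β i) t : ℂ))
    (hermiteSchwartz_eq_prod β) j hg x
  rw [prod_update_eq, h] at h1
  rw [sub_apply, smul_apply, mulCoord_apply, h1, smul_eq_mul, hermiteSchwartz_eq_prod,
    hermiteSchwartz_eq_prod, ← Finset.mul_prod_erase _ _ (Finset.mem_univ j),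
    ← Finset.mul_prod_erase Finset.univ (fun i => (hermiteFun (β i) (x i) : ℂ))
      (Finset.mem_univ j), h, hj]
  push_cast
  ring

end PilipovicSpaces

namespace PilipovicSpaces

open SchwartzMap

/-! ### Hermite coefficients of Schwartz functions -/

theorem integrable_mul_schwartz {d : ℕ} (ψ χ : 𝓢(Space d, ℂ)) :
    MeasureTheory.Integrable fun x => ψ x * χ x :=
  ((SchwartzMap.pairing (ContinuousLinearMap.mul ℂ ℂ) ψ χ).integrable
    (μ := MeasureTheory.volume)).congr (.of_forall fun x => by
      rw [SchwartzMap.pairing_apply_apply, ContinuousLinearMap.mul_apply'])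

theorem integrable_mul_hermiteFn {d : ℕ} (ψ : 𝓢(Space d, ℂ)) (α : MultiIndex d) :
    MeasureTheory.Integrable fun x => ψ x * (hermiteFn α x : ℂ) := by
  simpa only [hermiteSchwartz_apply] using integrable_mul_schwartz ψ (hermiteSchwartz α)

/-- The Hermite coefficient as a linear functional on the Schwartz space. -/
noncomputable def hermiteCoeffLM {d : ℕ} (α : MultiIndex d) : 𝓢(Space d, ℂ) →ₗ[ℂ] ℂ where
  toFun ψ := hermiteCoeff ψ α
  map_add' ψ χ := by
    simp only [hermiteCoeff, add_apply, add_mul]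
    exact MeasureTheory.integral_add (integrable_mul_hermiteFn ψ α) (integrable_mul_hermiteFn χ α)
  map_smul' r ψ := by
    simp only [hermiteCoeff, smul_apply, smul_eq_mul, mul_assoc, RingHom.id_apply]
    exact MeasureTheory.integral_const_mul r _

theorem hermiteCoeffLM_apply {d : ℕ} (α : MultiIndex d) (ψ : 𝓢(Space d, ℂ)) :
    hermiteCoeffLM α ψ = hermiteCoeff ψ α := rfl

theorem hermiteCoeffLM_eq_integral {d : ℕ} (α : MultiIndex d) (ψ : 𝓢(Space d, ℂ)) :
    hermiteCoeffLM α ψ = ∫ x, ψ x * hermiteSchwartz α x := by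
  simp only [hermiteSchwartz_apply]
  rfl

theorem integral_derivCoord_mul {d : ℕ} (j : Fin d) (ψ χ : 𝓢(Space d, ℂ)) :
    ∫ x, derivCoord j ψ x * χ x = -∫ x, ψ x * derivCoord j χ x := by
  have := integral_mul_lineDerivOp_right_eq_neg_left (μ := MeasureTheory.volume) ψ χ
    (EuclideanSpace.single j (1 : ℝ))
  simp only [derivCoord, LineDeriv.lineDerivOpCLM_apply]
  rw [this, neg_neg]

theorem integral_mulCoord_mul {d : ℕ} (j : Fin d) (ψ χ : 𝓢(Space d, ℂ)) :
    ∫ x, mulCoord j ψ x * χ x = ∫ x, ψ x * mulCoord j χ x := by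
  congr 1
  ext x
  rw [mulCoord_apply, mulCoord_apply]
  ring

/-- Integration by parts moves `x_j + ∂_j` onto `h_α` as the creation operator `x_j - ∂_j`. -/
theorem hermiteCoeffLM_mulCoord_add_derivCoord {d : ℕ} (j : Fin d) (α : MultiIndex d)
    (ψ : 𝓢(Space d, ℂ)) :
    hermiteCoeffLM α (mulCoord j ψ + derivCoord j ψ) =
      (Real.sqrt (2 * (α j + 1)) : ℂ) * hermiteCoeffLM (α + Pi.single j 1) ψ := by
  rw [map_add]
  simp only [hermiteCoeffLM_eq_integral]
  rw [integral_derivCoord_mul, integral_mulCoord_mul, derivCoord_hermiteSchwartz]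
  simp only [sub_apply, mul_sub, smul_apply, smul_eq_mul, mul_left_comm _ (Real.sqrt _ : ℂ)]
  rw [MeasureTheory.integral_sub (integrable_mul_schwartz _ _)
    ((integrable_mul_schwartz _ _).const_mul _), MeasureTheory.integral_const_mul]
  ring

/-- Integration by parts again, the operator arriving at the Hermite function now being the
annihilation operator. Indexing by `α + e_j` avoids a separate case for degree zero. -/
theorem hermiteCoeffLM_mulCoord_sub_derivCoord {d : ℕ} (j : Fin d) (α : MultiIndex d)
    (ψ : 𝓢(Space d, ℂ)) :
    hermiteCoeffLM (α + Pi.single j 1) (mulCoord j ψ - derivCoord j ψ) =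
      (Real.sqrt (2 * (α j + 1)) : ℂ) * hermiteCoeffLM α ψ := by
  rw [map_sub]
  simp only [hermiteCoeffLM_eq_integral]
  rw [integral_derivCoord_mul, integral_mulCoord_mul, derivCoord_hermiteSchwartz_add_single]
  simp only [sub_apply, mul_sub, smul_apply, smul_eq_mul, mul_left_comm _ (Real.sqrt _ : ℂ)]
  rw [MeasureTheory.integral_sub ((integrable_mul_schwartz _ _).const_mul _)
    (integrable_mul_schwartz _ _), MeasureTheory.integral_const_mul]
  ring

/-- The one-dimensional harmonic oscillator `(x_j + ∂_j)(x_j - ∂_j) = x_j² - ∂_j² + 1` in the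
`j`-th coordinate. -/
noncomputable def oscillator {d : ℕ} (j : Fin d) : 𝓢(Space d, ℂ) →L[ℂ] 𝓢(Space d, ℂ) :=
  (mulCoord j + derivCoord j) ∘L (mulCoord j - derivCoord j)

theorem oscillator_apply {d : ℕ} (j : Fin d) (ψ : 𝓢(Space d, ℂ)) :
    oscillator j ψ = mulCoord j (mulCoord j ψ - derivCoord j ψ) +
      derivCoord j (mulCoord j ψ - derivCoord j ψ) := rfl

theorem hermiteCoeffLM_oscillator {d : ℕ} (j : Fin d) (α : MultiIndex d) (ψ : 𝓢(Space d, ℂ)) :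
    hermiteCoeffLM α (oscillator j ψ) = (2 * (α j + 1) : ℂ) * hermiteCoeffLM α ψ := by
  rw [oscillator_apply, hermiteCoeffLM_mulCoord_add_derivCoord,
    hermiteCoeffLM_mulCoord_sub_derivCoord, ← mul_assoc, ← Complex.ofReal_mul,
    Real.mul_self_sqrt (by positivity)]
  push_cast
  ring

theorem hermiteCoeffLM_oscillator_iterate {d : ℕ} (j : Fin d) (α : MultiIndex d) (m : ℕ)
    (ψ : 𝓢(Space d, ℂ)) :
    hermiteCoeffLM α ((oscillator j)^[m] ψ) =
      (2 * (α j + 1) : ℂ) ^ m * hermiteCoeffLM α ψ := by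
  induction m with
  | zero => simp
  | succ m ih =>
    rw [Function.iterate_succ_apply', hermiteCoeffLM_oscillator, ih]
    ring

theorem abs_hermiteFn_le {d : ℕ} (α : MultiIndex d) (x : Space d) :
    |hermiteFn α x| ≤ 64 ^ d * (1 + (α.length : ℝ)) ^ (2 * d) * ∏ i, (1 + x i ^ 2)⁻¹ := by
  rw [hermiteFn, Finset.abs_prod]
  calc ∏ i, |hermiteFun (α i) (x i)|
      ≤ ∏ i, (64 * ((α i : ℝ) + 1) ^ 2 * (1 + x i ^ 2)⁻¹) := by
        refine Finset.prod_le_prod (fun i _ => abs_nonneg _) fun i _ => ?_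
        rw [← div_eq_mul_inv, le_div_iff₀ (by positivity), mul_comm]
        exact abs_hermiteFun_le (α i) (x i)
    _ = 64 ^ d * (∏ i, ((α i : ℝ) + 1) ^ 2) * ∏ i, (1 + x i ^ 2)⁻¹ := by
        rw [Finset.prod_mul_distrib, Finset.prod_mul_distrib]
        simp
    _ ≤ _ := by
        gcongr
        exact α.prod_le_one_add_length_pow 2

theorem integrable_prod_inv_one_add_sq (d : ℕ) :
    MeasureTheory.Integrable fun x : Space d => ∏ i, (1 + x i ^ 2)⁻¹ := by
  have h : MeasureTheory.Integrable (fun x : Fin d → ℝ => ∏ i, (1 + x i ^ 2)⁻¹)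
      (MeasureTheory.Measure.pi fun _ => MeasureTheory.volume) :=
    MeasureTheory.Integrable.fintype_prod (f := fun _ (t : ℝ) => (1 + t ^ 2)⁻¹)
      fun _ => integrable_inv_one_add_sq
  exact (PiLp.volume_preserving_ofLp (Fin d)).integrable_comp_of_integrable h

/-- Hermite coefficients are bounded by the supremum norm, polynomially in the multi-index. -/
theorem exists_norm_hermiteCoeffLM_le (d : ℕ) : ∃ K : ℝ, 0 ≤ K ∧
    ∀ (α : MultiIndex d) (ψ : 𝓢(Space d, ℂ)) (M : ℝ), (∀ x, ‖ψ x‖ ≤ M) →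
      ‖hermiteCoeffLM α ψ‖ ≤ K * (1 + (α.length : ℝ)) ^ (2 * d) * M := by
  refine ⟨64 ^ d * ∫ x : Space d, ∏ i, (1 + x i ^ 2)⁻¹,
    mul_nonneg (by positivity) (MeasureTheory.integral_nonneg fun x =>
      Finset.prod_nonneg fun i _ => by positivity), fun α ψ M hM => ?_⟩
  have h := MeasureTheory.norm_integral_le_of_norm_le (f := fun x => ψ x * (hermiteFn α x : ℂ))
    ((integrable_prod_inv_one_add_sq d).const_mul (M * (64 ^ d * (1 + (α.length : ℝ)) ^ (2 * d))))
    (.of_forall fun x => by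
      rw [norm_mul, Complex.norm_real, Real.norm_eq_abs, mul_assoc]
      exact mul_le_mul (hM x) (abs_hermiteFn_le α x) (abs_nonneg _) ((norm_nonneg _).trans (hM x)))
  refine (le_of_eq rfl).trans (h.trans (le_of_eq ?_))
  rw [MeasureTheory.integral_const_mul]
  ring

/-! ### Decay of the Hermite coefficients of Schwartz functions -/

/-- The operator `1 + ∑_j (x_j² - ∂_j² + 1)`. -/
noncomputable def totalOscillator (d : ℕ) : 𝓢(Space d, ℂ) →L[ℂ] 𝓢(Space d, ℂ) :=
  ContinuousLinearMap.id ℂ _ + ∑ j, oscillator j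

theorem hermiteCoeffLM_totalOscillator {d : ℕ} (α : MultiIndex d) (ψ : 𝓢(Space d, ℂ)) :
    hermiteCoeffLM α (totalOscillator d ψ) =
      ((1 + 2 * (α.length + d) : ℝ) : ℂ) * hermiteCoeffLM α ψ := by
  have h : totalOscillator d ψ = ψ + ∑ j, oscillator j ψ := by
    simp [totalOscillator]
  rw [h, map_add, map_sum]
  simp only [hermiteCoeffLM_oscillator, ← Finset.sum_mul, ← Finset.mul_sum,
    Finset.sum_add_distrib, MultiIndex.length]
  push_cast
  simp
  ring

theorem norm_hermiteCoeffLM_totalOscillator_pow {d : ℕ} (α : MultiIndex d) (ψ : 𝓢(Space d, ℂ))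
    (m : ℕ) : (1 + (α.length : ℝ)) ^ m * ‖hermiteCoeffLM α ψ‖ ≤
      ‖hermiteCoeffLM α ((totalOscillator d ^ m) ψ)‖ := by
  induction m with
  | zero => simp
  | succ m ih =>
    rw [pow_succ' (totalOscillator d), mul_apply_eq_comp,
      hermiteCoeffLM_totalOscillator, norm_mul, Complex.norm_real,
      Real.norm_of_nonneg (by positivity), pow_succ', mul_assoc]
    have hd : (0 : ℝ) ≤ d := d.cast_nonneg
    have hl : (0 : ℝ) ≤ α.length := Nat.cast_nonneg _
    gcongr
    linarith

/-- The Hermite coefficients of a Schwartz function are rapidly decreasing. -/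
theorem exists_schwartz_seminorm_le (d m : ℕ) : ∃ q : Seminorm ℂ 𝓢(Space d, ℂ), Continuous q ∧
    ∀ (α : MultiIndex d) (ψ : 𝓢(Space d, ℂ)),
      (1 + (α.length : ℝ)) ^ m * ‖hermiteCoeffLM α ψ‖ ≤ q ψ := by
  obtain ⟨K, hK, h⟩ := exists_norm_hermiteCoeffLM_le d
  -- The `2 * d` extra powers pay for the factor `(1 + |α|)^(2d)` in the supremum-norm bound of the
  -- coefficients.
  let T : 𝓢(Space d, ℂ) →L[ℂ] 𝓢(Space d, ℂ) := totalOscillator d ^ (m + 2 * d)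
  refine ⟨K.toNNReal • (SchwartzMap.seminorm ℂ 0 0).comp T.toLinearMap, ?_, fun α ψ => ?_⟩
  · have h1 : Continuous fun ψ => SchwartzMap.seminorm ℂ 0 0 (T ψ) :=
      ((schwartz_withSeminorms ℂ (Space d) ℂ).continuous_seminorm (0, 0)).comp T.continuous
    exact h1.const_smul K.toNNReal
  · have h1 := h α (T ψ) _ (SchwartzMap.norm_le_seminorm ℂ (T ψ))
    have h2 := (norm_hermiteCoeffLM_totalOscillator_pow α ψ (m + 2 * d)).trans h1
    have h3 : (K.toNNReal • (SchwartzMap.seminorm ℂ 0 0).comp T.toLinearMap) ψ =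
        K * SchwartzMap.seminorm ℂ 0 0 (T ψ) := by
      simp only [smul_apply, Seminorm.comp_apply, NNReal.smul_def, smul_eq_mul,
        Real.coe_toNNReal K hK]
      rfl
    rw [h3]
    have hp : 0 < (1 + (α.length : ℝ)) ^ (2 * d) := by positivity
    rw [pow_add] at h2
    refine le_of_mul_le_mul_right ?_ hp
    linarith

end PilipovicSpaces

namespace PilipovicSpaces

open SchwartzMap

/-! ### Decay of the Hermite coefficients of functions in `Σ₁` -/

theorem derivCoord_mulCoord {d : ℕ} (j : Fin d) (ψ : 𝓢(Space d, ℂ)) :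
    derivCoord j (mulCoord j ψ) = ψ + mulCoord j (derivCoord j ψ) := by
  ext x
  have h1 : HasFDerivAt (fun y : Space d => ((y j : ℝ) : ℂ))
      (Complex.ofRealCLM ∘L (EuclideanSpace.proj j : Space d →L[ℝ] ℝ)) x :=
    (Complex.ofRealCLM ∘L (EuclideanSpace.proj j : Space d →L[ℝ] ℝ)).hasFDerivAt
  have h2 := h1.fun_mul (ψ.hasFDerivAt x)
  have h3 : ⇑(mulCoord j ψ) = fun y : Space d => (y j : ℂ) * ψ y := funext (mulCoord_apply j ψ)
  rw [add_apply, mulCoord_apply, derivCoord, LineDeriv.lineDerivOpCLM_apply,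
    LineDeriv.lineDerivOpCLM_apply, lineDerivOp_apply_eq_fderiv, lineDerivOp_apply_eq_fderiv, h3,
    h2.fderiv]
  simp
  ring

/-- Leibniz's rule has only two terms since `x_j` is linear. Order `b + 1` keeps the lower-order
term free of truncated subtraction. -/
theorem derivCoord_iterate_succ_mulCoord {d : ℕ} (j : Fin d) (b : ℕ) (ψ : 𝓢(Space d, ℂ)) :
    (derivCoord j)^[b + 1] (mulCoord j ψ) =
      mulCoord j ((derivCoord j)^[b + 1] ψ) + ((b : ℂ) + 1) • (derivCoord j)^[b] ψ := by
  induction b with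
  | zero => simp [derivCoord_mulCoord, add_comm]
  | succ b ih =>
    rw [Function.iterate_succ_apply', ih, map_add, map_smul, derivCoord_mulCoord,
      ← Function.iterate_succ_apply' (derivCoord j), ← Function.iterate_succ_apply' (derivCoord j)]
    push_cast
    module

theorem derivCoord_iterate_add {d : ℕ} (j : Fin d) (b : ℕ) (ψ χ : 𝓢(Space d, ℂ)) :
    (derivCoord j)^[b] (ψ + χ) = (derivCoord j)^[b] ψ + (derivCoord j)^[b] χ :=
  iterate_map_add _ _ _ _

/-- Factorial bounds in the `j`-th variable for `x_j^a ∂_j^b ψ`, shifted by `n` and `L`. -/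
def FactorialBound {d : ℕ} (j : Fin d) (h : ℝ) (L : ℕ) (ψ : 𝓢(Space d, ℂ)) (n : ℕ) (C : ℝ) : Prop :=
  ∀ (a b : ℕ) (x : Space d), ‖(x j : ℂ) ^ a * (derivCoord j)^[b] ψ x‖ ≤
    C * (h ^ (a + b + n) * (a + b + n + L).factorial)

namespace FactorialBound

variable {d : ℕ} {j : Fin d} {h : ℝ} {L n : ℕ} {ψ χ : 𝓢(Space d, ℂ)} {C C' : ℝ}

theorem add (hψ : FactorialBound j h L ψ n C) (hχ : FactorialBound j h L χ n C') :
    FactorialBound j h L (ψ + χ) n (C + C') := fun a b x => by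
  rw [derivCoord_iterate_add, add_apply, mul_add, add_mul]
  exact (norm_add_le _ _).trans (add_le_add (hψ a b x) (hχ a b x))

theorem neg (hψ : FactorialBound j h L ψ n C) : FactorialBound j h L (-ψ) n C := fun a b x => by
  rw [iterate_map_neg, neg_apply, mul_neg, norm_neg]
  exact hψ a b x

theorem sub (hψ : FactorialBound j h L ψ n C) (hχ : FactorialBound j h L χ n C') :
    FactorialBound j h L (ψ - χ) n (C + C') := by
  rw [sub_eq_add_neg]
  exact hψ.add hχ.neg

theorem derivCoord (hψ : FactorialBound j h L ψ n C) :
    FactorialBound j h L (derivCoord j ψ) (n + 1) C := fun a b x => by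
  have := hψ a (b + 1) x
  rw [Function.iterate_succ_apply] at this
  rwa [show a + b + (n + 1) = a + (b + 1) + n by ring]

/-- The commutator of `∂_j^b` with `x_j` costs a factor `b` but has total order lower by two. The
gain `h² (N + 2)(N + 1)` from those two orders beats this factor once `h² L ≥ 1`, which is the
purpose of the shift `L` in the factorial. Main term and commutator contribute `C` each. -/
theorem mulCoord (hh : 0 < h) (hL : 1 ≤ h ^ 2 * L) (hC : 0 ≤ C) (hψ : FactorialBound j h L ψ n C) :
    FactorialBound j h L (mulCoord j ψ) (n + 1) (2 * C) := fun a b x => by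
  rcases b with _ | b
  · have := hψ (a + 1) 0 x
    rw [show a + 0 + (n + 1) = a + 1 + 0 + n by ring]
    simp only [Function.iterate_zero, id_eq, mulCoord_apply] at this ⊢
    rw [← mul_assoc, ← pow_succ]
    refine this.trans ?_
    gcongr
    linarith
  · have h1 := hψ (a + 1) (b + 1) x
    have h2 := hψ a b x
    rw [derivCoord_iterate_succ_mulCoord, add_apply, mulCoord_apply, smul_apply, smul_eq_mul,
      mul_add, ← mul_assoc, ← pow_succ, mul_left_comm]
    refine (norm_add_le _ _).trans ?_
    rw [norm_mul ((b : ℂ) + 1)]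
    have hb : ‖(b : ℂ) + 1‖ = b + 1 := by
      have : ((b : ℂ) + 1) = ((b + 1 : ℕ) : ℂ) := by push_cast; rfl
      rw [this, Complex.norm_natCast]
      push_cast
      rfl
    rw [hb]
    obtain ⟨N, hN⟩ : ∃ N, N = a + b + n + L := ⟨_, rfl⟩
    rw [show a + 1 + (b + 1) + n = a + b + n + 2 by ring,
      show a + b + n + 2 + L = N + 2 by rw [hN]; ring] at h1
    rw [← hN] at h2
    rw [show a + (b + 1) + (n + 1) = a + b + n + 2 by ring,
      show a + b + n + 2 + L = N + 2 by rw [hN]; ring]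
    have hNL : (L : ℝ) ≤ N := by
      rw [hN]
      push_cast
      linarith [a.cast_nonneg (α := ℝ), b.cast_nonneg (α := ℝ), n.cast_nonneg (α := ℝ),
        L.cast_nonneg (α := ℝ)]
    have hNb : (b : ℝ) ≤ N := by
      rw [hN]
      push_cast
      linarith [a.cast_nonneg (α := ℝ), b.cast_nonneg (α := ℝ), n.cast_nonneg (α := ℝ),
        L.cast_nonneg (α := ℝ)]
    have key : ((b : ℝ) + 1) * (h ^ (a + b + n) * N.factorial) ≤
        h ^ (a + b + n + 2) * (N + 2).factorial := by
      have h3 : (b : ℝ) + 1 ≤ h ^ 2 * (((N : ℝ) + 2) * (N + 1)) := by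
        have h4 : 1 ≤ h ^ 2 * ((N : ℝ) + 1) := hL.trans (by gcongr; linarith)
        calc (b : ℝ) + 1 ≤ (N + 2) * 1 := by linarith
          _ ≤ ((N : ℝ) + 2) * (h ^ 2 * ((N : ℝ) + 1)) := by gcongr
          _ = _ := by ring
      rw [Nat.factorial_succ, Nat.factorial_succ]
      push_cast
      calc ((b : ℝ) + 1) * (h ^ (a + b + n) * N.factorial)
          ≤ (h ^ 2 * (((N : ℝ) + 2) * (N + 1))) * (h ^ (a + b + n) * N.factorial) := by gcongr
        _ = _ := by ring
    calc _ ≤ C * (h ^ (a + b + n + 2) * (N + 2).factorial) +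
          ((b : ℝ) + 1) * (C * (h ^ (a + b + n) * N.factorial)) := by gcongr
      _ = C * (h ^ (a + b + n + 2) * (N + 2).factorial) +
          C * (((b : ℝ) + 1) * (h ^ (a + b + n) * N.factorial)) := by ring
      _ ≤ C * (h ^ (a + b + n + 2) * (N + 2).factorial) +
          C * (h ^ (a + b + n + 2) * (N + 2).factorial) := by gcongr
      _ = _ := by ring

/-- Each of the two factors `x_j ± ∂_j` raises the order by one and multiplies the constant by `2 +
1`. -/
theorem oscillator (hh : 0 < h) (hL : 1 ≤ h ^ 2 * L) (hC : 0 ≤ C)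
    (hψ : FactorialBound j h L ψ n C) :
    FactorialBound j h L (oscillator j ψ) (n + 2) (9 * C) := by
  have h1 := (hψ.mulCoord hh hL hC).sub hψ.derivCoord
  have h2 := (h1.mulCoord hh hL (by positivity)).add h1.derivCoord
  rw [oscillator_apply]
  convert! h2 using 1
  ring

theorem oscillator_iterate (hh : 0 < h) (hL : 1 ≤ h ^ 2 * L) (hC : 0 ≤ C)
    (hψ : FactorialBound j h L ψ 0 C) (m : ℕ) :
    FactorialBound j h L ((PilipovicSpaces.oscillator j)^[m] ψ) (2 * m) (9 ^ m * C) := by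
  induction m with
  | zero => simpa using hψ
  | succ m ih =>
    rw [Function.iterate_succ_apply']
    have := ih.oscillator hh hL (by positivity)
    rw [← mul_assoc, ← pow_succ'] at this
    exact this

end FactorialBound

/-! ### From the seminorms of `Σ₁` to bounds in one coordinate, and exponential decay of the
coefficients. -/

theorem MultiIndex.length_single {d : ℕ} (j : Fin d) (a : ℕ) :
    MultiIndex.length (Pi.single j a : MultiIndex d) = a := by
  simp [MultiIndex.length]

theorem MultiIndex.fact_single {d : ℕ} (j : Fin d) (a : ℕ) :
    MultiIndex.fact (Pi.single j a : MultiIndex d) = a.factorial := by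
  rw [MultiIndex.fact, Finset.prod_eq_single j]
  · simp
  · intro i _ hi
    simp [hi]
  · simp

theorem MultiIndex.length_add {d : ℕ} (α β : MultiIndex d) :
    (α + β).length = α.length + β.length := by
  simp [MultiIndex.length, Finset.sum_add_distrib]

theorem monomial_single {d : ℕ} (j : Fin d) (a : ℕ) (x : Space d) :
    monomial (Pi.single j a) x = x j ^ a := by
  rw [monomial, Finset.prod_eq_single j]
  · simp
  · intro i _ hi
    simp [hi]
  · simp

theorem partialDeriv_single {d : ℕ} (j : Fin d) (b : ℕ) (ψ : 𝓢(Space d, ℂ)) :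
    partialDeriv (Pi.single j b) ψ = (derivCoord j)^[b] ψ := by
  have h : partialDeriv (Pi.single j b : MultiIndex d) = derivCoord j ^ b := by
    rw [partialDeriv, List.ofFn_eq_map, List.prod_map_eq_pow_single j]
    · rw [List.count_eq_one_of_mem (List.nodup_finRange d) (List.mem_finRange j)]
      simp [derivCoord]
    · intro i hi _
      simp [hi]
  rw [h, FunLike.coe_pow_eq_iterate]

theorem SigmaOne.le_seminorm {d : ℕ} (h : {h : ℝ // 0 < h}) (φ : SigmaOne d)
    (α β : MultiIndex d) (x : Space d) :
    ‖(monomial α x : ℂ) * partialDeriv β (SigmaOne.toSchwartz φ) x‖ ≤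
      SigmaOne.seminorms d h φ * (h.1 ^ (α + β).length * α.fact * β.fact) := by
  have h1 : ‖SigmaOne.weightedDeriv h.1 (α, β, x) φ‖ ≤ SigmaOne.seminorms d h φ :=
    le_ciSup (SigmaOne.bddAbove_weightedDeriv h φ) (α, β, x)
  rw [SigmaOne.norm_weightedDeriv h.2] at h1
  have h2 : 0 < α.fact := Finset.prod_pos fun i _ => Nat.factorial_pos _
  have h3 : 0 < β.fact := Finset.prod_pos fun i _ => Nat.factorial_pos _
  have h4 := h.2
  rw [div_le_iff₀ (by positivity)] at h1
  exact h1

/-- Only multi-indices supported at `j` are needed, together with `a! b! ≤ (a + b)!`. -/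
theorem SigmaOne.factorialBound {d : ℕ} (j : Fin d) (h : {h : ℝ // 0 < h}) (L : ℕ)
    (φ : SigmaOne d) :
    FactorialBound j h.1 L (SigmaOne.toSchwartz φ) 0 (SigmaOne.seminorms d h φ) := fun a b x => by
  have h1 := SigmaOne.le_seminorm h φ (Pi.single j a) (Pi.single j b) x
  rw [monomial_single, partialDeriv_single, MultiIndex.length_add, MultiIndex.length_single,
    MultiIndex.length_single, MultiIndex.fact_single, MultiIndex.fact_single] at h1
  push_cast at h1
  refine h1.trans ?_
  have h2 : a.factorial * b.factorial ≤ (a + b + 0 + L).factorial :=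
    (Nat.le_of_dvd (Nat.factorial_pos _) (Nat.factorial_mul_factorial_dvd_factorial_add a b)).trans
      (Nat.factorial_le (by omega))
  have h3 : (a.factorial : ℝ) * b.factorial ≤ ((a + b + 0 + L).factorial : ℝ) := by
    exact_mod_cast h2
  have h4 := h.2
  rw [mul_assoc (h.1 ^ _), add_zero]
  have h5 : 0 ≤ SigmaOne.seminorms d h φ := apply_nonneg _ _
  rw [add_zero] at h3
  gcongr

theorem factorial_add_le (n L : ℕ) :
    ((n + L).factorial : ℝ) ≤ 2 ^ (n + L) * (n.factorial * L.factorial) := by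
  have h1 := Nat.add_choose_mul_factorial_mul_factorial n L
  have h2 := Nat.choose_le_two_pow (n + L) L
  have h3 : (n + L).factorial ≤ 2 ^ (n + L) * (n.factorial * L.factorial) := by
    rw [← h1, mul_assoc]
    exact Nat.mul_le_mul_right _ h2
  exact_mod_cast h3

/-- Powers of the oscillator control only even powers of `Y`, so the series of `cosh` is summed
instead, and `exp Y ≤ 2 cosh Y`. -/
theorem exp_mul_sqrt_mul_le {Y c A : ℝ} (hc : 0 ≤ c)
    (h : ∀ m : ℕ, Y ^ (2 * m) * c ≤ A * (1 / 2) ^ m * (2 * m).factorial) :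
    Real.exp Y * c ≤ 4 * A := by
  have h1 := (Real.hasSum_cosh Y).mul_right c
  have h2 := hasSum_geometric_two.mul_left A
  have h3 : Real.cosh Y * c ≤ A * 2 := hasSum_le (fun m => by
    rw [div_mul_eq_mul_div, div_le_iff₀ (by positivity)]
    exact h m) h1 h2
  have h4 : Real.exp Y ≤ 2 * Real.cosh Y := by
    rw [Real.cosh_eq]
    linarith [Real.exp_pos (-Y)]
  nlinarith

/-- Applying the `m`-th power of the oscillator multiplies the coefficient by `(2(α_j + 1))^m`,
while the supremum norm grows only like `(9 h²)^m (2m + L)!`. Dividing by `(2m)!` and summing over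
`m` gives the exponential. -/
theorem exists_exp_sqrt_mul_norm_hermiteCoeffLM_le (d : ℕ) {r : ℝ} (hr : 0 < r) :
    ∃ h : {h : ℝ // 0 < h}, ∃ A : ℝ, 0 ≤ A ∧ ∀ (j : Fin d) (α : MultiIndex d) (φ : SigmaOne d),
      Real.exp (r * Real.sqrt (α j)) * ‖hermiteCoeffLM α (SigmaOne.toSchwartz φ)‖ ≤
        A * (1 + (α.length : ℝ)) ^ (2 * d) * SigmaOne.seminorms d h φ := by
  obtain ⟨K, hK, hKb⟩ := exists_norm_hermiteCoeffLM_le d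
  -- The value of `h` solves `r² · 9 · h² · 2² = 1`, where `9` is the cost of one oscillator and
  -- `2²` that of splitting `(2m + L)!`.
  have hh : 0 < 1 / (6 * r) := by positivity
  obtain ⟨L, hL⟩ := exists_nat_ge (((1 / (6 * r)) ^ 2)⁻¹)
  have hL1 : 1 ≤ (1 / (6 * r)) ^ 2 * (L : ℝ) := by
    rwa [← inv_mul_le_iff₀ (by positivity), mul_one]
  refine ⟨⟨1 / (6 * r), hh⟩, 4 * (K * (2 ^ L * L.factorial)), by positivity, fun j α φ => ?_⟩
  set p := SigmaOne.seminorms d ⟨1 / (6 * r), hh⟩ φ with hp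
  have hp0 : 0 ≤ p := apply_nonneg _ _
  have h1 := (SigmaOne.factorialBound j ⟨1 / (6 * r), hh⟩ L φ).oscillator_iterate hh hL1 hp0
  have key := exp_mul_sqrt_mul_le (Y := r * Real.sqrt (α j))
    (norm_nonneg (hermiteCoeffLM α (SigmaOne.toSchwartz φ)))
    (A := K * (1 + (α.length : ℝ)) ^ (2 * d) * (p * (2 ^ L * L.factorial))) (fun m => by
      have h2 : ∀ x, ‖(oscillator j)^[m] (SigmaOne.toSchwartz φ) x‖ ≤
          9 ^ m * p * ((1 / (6 * r)) ^ (2 * m) * (2 ^ (2 * m + L) *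
            ((2 * m).factorial * L.factorial))) := fun x => by
        have h3 := h1 m 0 0 x
        simp only [pow_zero, Function.iterate_zero, id_eq, one_mul, zero_add] at h3
        refine h3.trans ?_
        gcongr
        exact factorial_add_le _ _
      have h4 := hKb α _ _ h2
      rw [hermiteCoeffLM_oscillator_iterate, norm_mul, norm_pow] at h4
      have h5 : ‖(2 * (α j + 1) : ℂ)‖ = 2 * ((α j : ℝ) + 1) := by
        have : (2 * (α j + 1) : ℂ) = ((2 * (α j + 1) : ℕ) : ℂ) := by push_cast; rfl
        rw [this, Complex.norm_natCast]
        push_cast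
        rfl
      rw [h5] at h4
      -- The factor `2` of the eigenvalue `2(α_j + 1)` supplies the ratio `1/2` that makes the sum
      -- over `m` converge.
      have h6 : (r * Real.sqrt (α j)) ^ (2 * m) ≤ (r ^ 2) ^ m * (1 / 2) ^ m *
          (2 * ((α j : ℝ) + 1)) ^ m := by
        rw [← mul_pow, ← mul_pow, pow_mul]
        refine pow_le_pow_left₀ (by positivity) ?_ m
        rw [mul_pow, Real.sq_sqrt (by positivity)]
        nlinarith [sq_nonneg r]
      have h7 : (r ^ 2) ^ m * (9 ^ m * ((1 / (6 * r)) ^ (2 * m) * 2 ^ (2 * m))) = 1 := by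
        rw [pow_mul, pow_mul, ← mul_pow, ← mul_pow, ← mul_pow]
        rw [show r ^ 2 * (9 * ((1 / (6 * r)) ^ 2 * 2 ^ 2)) = 1 by field_simp; norm_num, one_pow]
      calc (r * Real.sqrt (α j)) ^ (2 * m) * ‖hermiteCoeffLM α (SigmaOne.toSchwartz φ)‖
          ≤ ((r ^ 2) ^ m * (1 / 2) ^ m * (2 * ((α j : ℝ) + 1)) ^ m) *
            ‖hermiteCoeffLM α (SigmaOne.toSchwartz φ)‖ := by gcongr
        _ = (r ^ 2) ^ m * (1 / 2) ^ m * ((2 * ((α j : ℝ) + 1)) ^ m *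
            ‖hermiteCoeffLM α (SigmaOne.toSchwartz φ)‖) := by ring
        _ ≤ (r ^ 2) ^ m * (1 / 2) ^ m * (K * (1 + (α.length : ℝ)) ^ (2 * d) *
            (9 ^ m * p * ((1 / (6 * r)) ^ (2 * m) * (2 ^ (2 * m + L) *
            ((2 * m).factorial * L.factorial))))) := by gcongr
        _ = ((r ^ 2) ^ m * (9 ^ m * ((1 / (6 * r)) ^ (2 * m) * 2 ^ (2 * m)))) *
            (K * (1 + (α.length : ℝ)) ^ (2 * d) * (p * (2 ^ L * L.factorial)) * (1 / 2) ^ m *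
              (2 * m).factorial) := by rw [pow_add]; ring
        _ = _ := by rw [h7, one_mul])
  refine key.trans (le_of_eq ?_)
  ring

theorem one_add_pow_le_exp_sqrt (n m : ℕ) :
    (1 + (n : ℝ)) ^ m ≤ (2 * m).factorial * Real.exp 1 * Real.exp (Real.sqrt n) := by
  have h1 := Real.pow_div_factorial_le_exp (1 + Real.sqrt n) (by positivity) (2 * m)
  rw [div_le_iff₀ (by positivity), Real.exp_add] at h1
  calc (1 + (n : ℝ)) ^ m ≤ ((1 + Real.sqrt n) ^ 2) ^ m := by
        gcongr
        nlinarith [Real.sq_sqrt (n.cast_nonneg (α := ℝ)), Real.sqrt_nonneg (n : ℝ)]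
    _ = (1 + Real.sqrt n) ^ (2 * m) := by rw [pow_mul]
    _ ≤ _ := h1
    _ = _ := by ring

/-- The Hermite coefficients of functions in `Σ₁` decay faster than `exp(-r √|α|)`, for all `r`. -/
theorem exists_sigmaOne_seminorm_le (d m : ℕ) {r : ℝ} (hr : 0 < r) :
    ∃ q : Seminorm ℂ (SigmaOne d), Continuous q ∧ ∀ (α : MultiIndex d) (φ : SigmaOne d),
      (1 + (α.length : ℝ)) ^ m * (Real.exp (r * Real.sqrt α.length) *
        ‖hermiteCoeffLM α (SigmaOne.toSchwartz φ)‖) ≤ q φ := by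
  obtain ⟨h, A, hA, hb⟩ : ∃ h : {h : ℝ // 0 < h}, ∃ A : ℝ, 0 ≤ A ∧
      ∀ (α : MultiIndex d) (φ : SigmaOne d), (1 + (α.length : ℝ)) ^ m *
        (Real.exp (r * Real.sqrt α.length) * ‖hermiteCoeffLM α (SigmaOne.toSchwartz φ)‖) ≤
          A * SigmaOne.seminorms d h φ := by
    rcases Nat.eq_zero_or_pos d with rfl | hd
    -- In dimension zero there is no coordinate to work with, but the only multi-index has length
    -- zero.
    · obtain ⟨K, hK, hKb⟩ := exists_norm_hermiteCoeffLM_le 0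
      refine ⟨⟨1, one_pos⟩, K, hK, fun α φ => ?_⟩
      have h1 := hKb α (SigmaOne.toSchwartz φ) (SigmaOne.seminorms 0 ⟨1, one_pos⟩ φ) fun x => by
        have := SigmaOne.le_seminorm ⟨1, one_pos⟩ φ 0 0 x
        simpa [monomial, partialDeriv, MultiIndex.length, MultiIndex.fact] using this
      have h2 : α.length = 0 := by simp [MultiIndex.length]
      simpa [h2] using h1
    -- The largest coordinate satisfies `|α| ≤ d α_j`, whence the `√d` in the rate; the surplus `1`
    -- in `r + 1` absorbs all polynomial factors.
    · obtain ⟨h, A, hA, hb⟩ := exists_exp_sqrt_mul_norm_hermiteCoeffLM_le d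
        (r := (r + 1) * Real.sqrt d) (by positivity)
      refine ⟨h, A * ((2 * (m + 2 * d)).factorial * Real.exp 1), by positivity, fun α φ => ?_⟩
      have : Nonempty (Fin d) := ⟨⟨0, hd⟩⟩
      obtain ⟨j, -, hj⟩ := Finset.exists_max_image Finset.univ α Finset.univ_nonempty
      have h1 : (α.length : ℝ) ≤ d * α j := by
        have : α.length ≤ d * α j := by
          calc α.length ≤ ∑ _i : Fin d, α j := Finset.sum_le_sum fun i hi => hj i hi
            _ = _ := by simp
        exact_mod_cast this
      have h2 : Real.sqrt α.length ≤ Real.sqrt d * Real.sqrt (α j) := by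
        rw [← Real.sqrt_mul (by positivity)]
        exact Real.sqrt_le_sqrt h1
      have h3 := hb j α φ
      have h4 := one_add_pow_le_exp_sqrt α.length (m + 2 * d)
      set c := ‖hermiteCoeffLM α (SigmaOne.toSchwartz φ)‖
      set p := SigmaOne.seminorms d h φ
      have hp : 0 ≤ p := apply_nonneg _ _
      have h5 : Real.exp (r * Real.sqrt α.length) * Real.exp (Real.sqrt α.length) * c ≤
          A * (1 + (α.length : ℝ)) ^ (2 * d) * p := by
        refine le_trans ?_ h3
        rw [← Real.exp_add]
        gcongr
        calc r * Real.sqrt α.length + Real.sqrt α.length = (r + 1) * Real.sqrt α.length := by ring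
          _ ≤ (r + 1) * (Real.sqrt d * Real.sqrt (α j)) := by gcongr
          _ = _ := by ring
      have h6 : (1 + (α.length : ℝ)) ^ (2 * d) * ((1 + (α.length : ℝ)) ^ m *
          (Real.exp (r * Real.sqrt α.length) * c)) ≤
          (1 + (α.length : ℝ)) ^ (2 * d) * (A * ((2 * (m + 2 * d)).factorial * Real.exp 1) * p) := by
        calc _ = (1 + (α.length : ℝ)) ^ (m + 2 * d) *
                (Real.exp (r * Real.sqrt α.length) * c) := by rw [pow_add]; ring
          _ ≤ ((2 * (m + 2 * d)).factorial * Real.exp 1 * Real.exp (Real.sqrt α.length)) *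
                (Real.exp (r * Real.sqrt α.length) * c) := by gcongr
          _ = (2 * (m + 2 * d)).factorial * Real.exp 1 *
                (Real.exp (r * Real.sqrt α.length) * Real.exp (Real.sqrt α.length) * c) := by ring
          _ ≤ (2 * (m + 2 * d)).factorial * Real.exp 1 *
                (A * (1 + (α.length : ℝ)) ^ (2 * d) * p) := by gcongr
          _ = _ := by ring
      exact le_of_mul_le_mul_left h6 (by positivity)
  refine ⟨A.toNNReal • SigmaOne.seminorms d h, ?_, fun α φ => ?_⟩
  · have h1 : Continuous (SigmaOne.seminorms d h) := SigmaOne.withSeminorms.continuous_seminorm h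
    exact h1.const_smul A.toNNReal
  · simpa only [smul_apply, NNReal.smul_def, smul_eq_mul, Real.coe_toNNReal A hA] using hb α φ

end PilipovicSpaces

namespace PilipovicSpaces

open SchwartzMap

/-! ### Hermite expansions of Gaussians -/

theorem MultiIndex.induction_add_single {d : ℕ} {P : MultiIndex d → Prop} (h0 : P 0)
    (hs : ∀ (α : MultiIndex d) (j : Fin d), P α → P (α + Pi.single j 1)) (α : MultiIndex d) :
    P α := by
  obtain ⟨n, hn⟩ : ∃ n, α.length = n := ⟨_, rfl⟩
  induction n generalizing α with
  | zero =>
    have : α = 0 := funext fun i => by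
      have := α.le_length i
      simp only [Pi.zero_apply]
      omega
    exact this ▸ h0
  | succ n ih =>
    obtain ⟨j, hj⟩ : ∃ j, α j ≠ 0 := by
      by_contra! h
      simp [MultiIndex.length, h] at hn
    obtain ⟨β, hβ⟩ : ∃ β : MultiIndex d, α = β + Pi.single j 1 := by
      refine ⟨Function.update α j (α j - 1), funext fun i => ?_⟩
      rcases eq_or_ne i j with rfl | hi
      · simp only [Pi.add_apply, Function.update_self, Pi.single_eq_same]
        omega
      · simp [hi]
    rw [hβ]
    refine hs β j (ih β ?_)
    rw [hβ, MultiIndex.length_add, MultiIndex.length_single] at hn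
    omega

theorem hasDerivAt_cexp_gaussian (w z : ℂ) :
    HasDerivAt (fun z => Complex.exp (w * z - z ^ 2 / 2))
      ((w - z) * Complex.exp (w * z - z ^ 2 / 2)) z :=
  ((((hasDerivAt_id' z).const_mul w).fun_sub
    (((hasDerivAt_id' z).fun_pow 2).div_const 2)).cexp).congr_deriv (by simp; ring)

theorem derivCoord_gaussian {d : ℕ} (j : Fin d) (w : Fin d → ℂ) :
    derivCoord j (gaussian w) = w j • gaussian w - mulCoord j (gaussian w) := by
  ext x
  rw [sub_apply, smul_apply, mulCoord_apply,
    derivCoord_apply_of_eq_prod (g := fun i t => Complex.exp (w i * (t : ℂ) - (t : ℂ) ^ 2 / 2))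
      (gaussian_apply_eq_prod w) j (fun t => (hasDerivAt_cexp_gaussian (w j) t).comp_ofReal),
    prod_update_eq, gaussian_apply_eq_prod, ← Finset.mul_prod_erase _ _ (Finset.mem_univ j),
    smul_eq_mul]
  ring

/-- The constant `π^(d/4)`. -/
noncomputable def gaussianConst (d : ℕ) : ℝ :=
  (Real.pi ^ (-(1 / 4) : ℝ)) ^ d * Real.pi ^ ((d : ℝ) / 2)

theorem gaussianConst_pos (d : ℕ) : 0 < gaussianConst d := by
  have := Real.pi_pos
  unfold gaussianConst
  positivity

theorem hermiteCoeffLM_zero_gaussian {d : ℕ} (w : Fin d → ℂ) :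
    hermiteCoeffLM 0 (gaussian w) = gaussianConst d * Complex.exp ((∑ i, w i ^ 2) / 4) := by
  have h1 : ∀ x : Space d, gaussian w x * (hermiteFn 0 x : ℂ) =
      (((Real.pi ^ (-(1 / 4) : ℝ)) ^ d : ℝ) : ℂ) *
        Complex.exp (-1 * ∑ i, (x i : ℂ) ^ 2 + ∑ i, w i * x i) := fun x => by
    have h2 : (hermiteFn 0 x : ℂ) = (((Real.pi ^ (-(1 / 4) : ℝ)) ^ d : ℝ) : ℂ) *
        ∏ i, Complex.exp (-(x i : ℂ) ^ 2 / 2) := by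
      simp [hermiteFn, hermiteFun, Finset.prod_mul_distrib, Complex.ofReal_prod]
    rw [h2, gaussian_apply_eq_prod, mul_left_comm, ← Finset.prod_mul_distrib]
    congr 1
    simp only [← Complex.exp_add]
    rw [← Complex.exp_sum, Finset.mul_sum, ← Finset.sum_add_distrib]
    congr 1
    exact Finset.sum_congr rfl fun i _ => by ring
  have h3 : hermiteCoeffLM 0 (gaussian w) = ∫ x : Space d, gaussian w x * (hermiteFn 0 x : ℂ) := rfl
  rw [h3]
  simp only [h1]
  rw [MeasureTheory.integral_const_mul]
  have h4 := (PiLp.volume_preserving_ofLp (Fin d)).integral_comp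
    (MeasurableEquiv.toLp 2 (Fin d → ℝ)).symm.measurableEmbedding
    (fun x : Fin d → ℝ => Complex.exp (-1 * ∑ i, (x i : ℂ) ^ 2 + ∑ i, w i * x i))
  have h5 := GaussianFourier.integral_cexp_neg_mul_sum_add (b := 1) (by simp) w
  rw [h4, h5, gaussianConst]
  have h6 : ((Real.pi ^ ((d : ℝ) / 2) : ℝ) : ℂ) = (Real.pi : ℂ) ^ ((d : ℂ) / 2) := by
    rw [Complex.ofReal_cpow Real.pi_pos.le]
    push_cast
    rfl
  rw [Complex.ofReal_mul, h6]
  simp [mul_assoc]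

theorem sqrt_fact_add_single {d : ℕ} (α : MultiIndex d) (j : Fin d) :
    Real.sqrt (α + Pi.single j 1).fact = Real.sqrt (α j + 1) * Real.sqrt α.fact := by
  have h : (α + Pi.single j 1).fact = (α j + 1) * α.fact := by
    rw [MultiIndex.fact, MultiIndex.fact, ← Finset.mul_prod_erase _ _ (Finset.mem_univ j),
      ← Finset.mul_prod_erase Finset.univ (fun i => (α i).factorial) (Finset.mem_univ j),
      ← mul_assoc, ← Nat.factorial_succ]
    congr 1
    · simp
    · exact Finset.prod_congr rfl fun i hi => by simp [Finset.ne_of_mem_erase hi]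
  rw [h, ← Real.sqrt_mul (by positivity)]
  push_cast
  rfl

theorem prod_pow_add_single {d : ℕ} (ζ : Fin d → ℂ) (α : MultiIndex d) (j : Fin d) :
    ∏ i, ζ i ^ (α + Pi.single j 1 : MultiIndex d) i = ζ j * ∏ i, ζ i ^ α i := by
  simp only [Pi.add_apply, pow_add, Finset.prod_mul_distrib]
  rw [mul_comm]
  congr 1
  rw [Finset.prod_eq_single j]
  · simp
  · intro i _ hi
    simp [hi]
  · simp

theorem MultiIndex.fact_pos {d : ℕ} (α : MultiIndex d) : 0 < α.fact :=
  Finset.prod_pos fun _ _ => Nat.factorial_pos _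

/-- Gaussians are coherent states: `(x_j + ∂_j)` multiplies `gaussian w` by `w j`. This gives the
recursion `√(2(α_j + 1)) c(α + e_j) = w_j c(α)`. -/
theorem hermiteCoeffLM_gaussian {d : ℕ} (w : Fin d → ℂ) (α : MultiIndex d) :
    hermiteCoeffLM α (gaussian w) = gaussianConst d * Complex.exp ((∑ i, w i ^ 2) / 4) *
      ((Real.sqrt α.fact : ℂ)⁻¹ * ∏ i, (w i / Real.sqrt 2) ^ α i) := by
  induction α using MultiIndex.induction_add_single with
  | h0 => simp [hermiteCoeffLM_zero_gaussian, MultiIndex.fact]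
  | hs α j ih =>
    have h1 := hermiteCoeffLM_mulCoord_add_derivCoord j α (gaussian w)
    rw [derivCoord_gaussian, add_sub_cancel, map_smul, ih, smul_eq_mul] at h1
    have h2 : (Real.sqrt 2 : ℂ) ≠ 0 := by
      have : Real.sqrt 2 ≠ 0 := by positivity
      exact_mod_cast this
    have h3 : (Real.sqrt (α j + 1) : ℂ) ≠ 0 := by
      have : Real.sqrt (α j + 1) ≠ 0 := by positivity
      exact_mod_cast this
    have h4 : (Real.sqrt α.fact : ℂ) ≠ 0 := by
      have h0 : (0 : ℝ) < α.fact := by exact_mod_cast α.fact_pos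
      have : Real.sqrt α.fact ≠ 0 := by positivity
      exact_mod_cast this
    rw [Real.sqrt_mul (by norm_num), Complex.ofReal_mul] at h1
    refine mul_left_cancel₀ (mul_ne_zero h2 h3) (h1.symm.trans ?_)
    rw [sqrt_fact_add_single, prod_pow_add_single, Complex.ofReal_mul]
    field_simp

/-- Needed because shifts are defined by testing on `HFlat`. The expansion is a product of
one-dimensional generating functions at `w i / √2`; the constants `k i` remove the factors
`π^(-1/4)` and `exp(-(w i)²/4)`. -/
theorem gaussian_mem_HFlat {d : ℕ} (w : Fin d → ℂ) : ⇑(gaussian w) ∈ HFlat d := by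
  have hp : (0 : ℝ) < Real.pi ^ (-(1 / 4) : ℝ) := by have := Real.pi_pos; positivity
  let k : Fin d → ℂ := fun i => ((Real.pi ^ (-(1 / 4) : ℝ) : ℝ) : ℂ)⁻¹ * Complex.exp (w i ^ 2 / 4)
  have h2 : (Real.sqrt 2 : ℂ) * (Real.sqrt 2 : ℂ) = 2 := by
    rw [← Complex.ofReal_mul, Real.mul_self_sqrt (by norm_num)]
    norm_num
  have h20 : (Real.sqrt 2 : ℂ) ≠ 0 := by
    have : Real.sqrt 2 ≠ 0 := by positivity
    exact_mod_cast this
  refine ⟨fun α => ∏ i, k i * ((w i / Real.sqrt 2) ^ α i / (Real.sqrt (α i).factorial : ℂ)),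
    ⟨1 + ∑ i, ‖w i / Real.sqrt 2‖, by positivity, ∏ i, ‖k i‖, fun α => ?_⟩, fun x => ?_⟩
  · have h3 : Real.sqrt α.fact = ∏ i, Real.sqrt (α i).factorial := by
      rw [MultiIndex.fact, Nat.cast_prod, Real.sqrt_prod _ fun i _ => by positivity]
    rw [h3, ← Finset.prod_inv_distrib, MultiIndex.length, ← Finset.prod_pow_eq_pow_sum,
      ← Finset.prod_mul_distrib, ← Finset.prod_mul_distrib, norm_prod]
    refine Finset.prod_le_prod (fun i _ => norm_nonneg _) fun i _ => ?_
    rw [norm_mul, norm_div, norm_pow, Complex.norm_real, Real.norm_of_nonneg (Real.sqrt_nonneg _),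
      div_eq_mul_inv, ← mul_assoc]
    gcongr
    have := Finset.single_le_sum (f := fun i => ‖w i / Real.sqrt 2‖)
      (fun i _ => norm_nonneg _) (Finset.mem_univ i)
    linarith
  · have h4 := hasSum_prod_multiIndex fun i : Fin d =>
      (hasSum_hermiteFun (x i) (w i / Real.sqrt 2)).mul_left (k i)
    convert! h4 using 1
    · ext α
      rw [hermiteFn, Complex.ofReal_prod, ← Finset.prod_mul_distrib]
      exact Finset.prod_congr rfl fun i _ => by ring
    · rw [gaussian_apply_eq_prod]
      refine Finset.prod_congr rfl fun i _ => ?_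
      have hp' : ((Real.pi ^ (-(1 / 4) : ℝ) : ℝ) : ℂ) ≠ 0 := by exact_mod_cast hp.ne'
      simp only [k]
      rw [mul_mul_mul_comm, inv_mul_cancel₀ hp', one_mul, ← Complex.exp_add]
      congr 1
      field_simp
      rw [show (Real.sqrt 2 : ℂ) ^ 2 = 2 by rw [pow_two, h2]]
      ring

/-! ### Gaussians belong to `Σ₁` -/

/-- With `R = 1/h`, Cauchy's estimate on the circle of radius `R` about `t` yields `b! h^b`, and the
exponential series yields `|t|^a ≤ h^a a! exp(R|t|)`. The Gaussian is still at most of size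
`exp(‖w‖|t| - t²/4)` on that circle, up to a constant, and this absorbs `exp(R|t|)`. -/
theorem exists_norm_iteratedDeriv_gaussian_le (w : ℂ) {h : ℝ} (hh : 0 < h) :
    ∃ C : ℝ, 0 ≤ C ∧ ∀ (a b : ℕ) (t : ℝ),
      |t| ^ a * ‖iteratedDeriv b (fun z => Complex.exp (w * z - z ^ 2 / 2)) t‖ ≤
        C * (h ^ (a + b) * a.factorial * b.factorial) := by
  set R : ℝ := 1 / h with hR
  have hR0 : 0 < R := by positivity
  refine ⟨Real.exp ((‖w‖ + R) ^ 2 + ‖w‖ * R + R ^ 2), by positivity, fun a b t => ?_⟩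
  have hd : Differentiable ℂ fun z => Complex.exp (w * z - z ^ 2 / 2) :=
    fun z => (hasDerivAt_cexp_gaussian w z).differentiableAt
  have h1 := Complex.norm_iteratedDeriv_le_of_forall_mem_sphere_norm_le (c := (t : ℂ))
    (C := Real.exp (‖w‖ * |t| + ‖w‖ * R - t ^ 2 / 4 + R ^ 2)) b hR0
    hd.diffContOnCl (fun z hz => by
      obtain ⟨s, rfl⟩ : ∃ s, z = t + s := ⟨z - t, by ring⟩
      have hs : ‖s‖ = R := by simpa using hz
      rw [Complex.norm_exp]
      refine Real.exp_le_exp.2 ?_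
      have e1 : (w * (t + s) - (t + s) ^ 2 / 2).re =
          (w * (t + s)).re - ((t + s.re) ^ 2 - s.im ^ 2) / 2 := by
        simp [pow_two]
      have e2 : (w * (t + s)).re ≤ ‖w‖ * |t| + ‖w‖ * R := by
        calc (w * (t + s)).re ≤ ‖w * (t + s)‖ := Complex.re_le_norm _
          _ ≤ ‖w‖ * (‖(t : ℂ)‖ + ‖s‖) := by
            rw [norm_mul]
            gcongr
            exact norm_add_le _ _
          _ = _ := by rw [hs, Complex.norm_real, Real.norm_eq_abs]; ring
      have e3 : s.re ^ 2 + s.im ^ 2 = R ^ 2 := by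
        rw [← hs, ← Complex.normSq_eq_norm_sq, Complex.normSq_apply]
        ring
      rw [e1]
      nlinarith [sq_nonneg (t + 2 * s.re), sq_nonneg s.im, sq_nonneg s.re])
  have h2 : |t| ^ a ≤ h ^ a * a.factorial * Real.exp (R * |t|) := by
    have := Real.pow_div_factorial_le_exp (R * |t|) (by positivity) a
    rw [div_le_iff₀ (by positivity), mul_pow] at this
    have e : h ^ a * R ^ a = 1 := by rw [← mul_pow, hR, mul_one_div_cancel hh.ne', one_pow]
    calc |t| ^ a = h ^ a * (R ^ a * |t| ^ a) := by rw [← mul_assoc, e, one_mul]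
      _ ≤ h ^ a * (Real.exp (R * |t|) * a.factorial) := by gcongr
      _ = _ := by ring
  have h3 : Real.exp (R * |t|) * Real.exp (‖w‖ * |t| + ‖w‖ * R - t ^ 2 / 4 + R ^ 2) ≤
      Real.exp ((‖w‖ + R) ^ 2 + ‖w‖ * R + R ^ 2) := by
    rw [← Real.exp_add]
    refine Real.exp_le_exp.2 ?_
    nlinarith [sq_nonneg (|t| / 2 - (‖w‖ + R)), sq_abs t]
  have e : (R ^ b)⁻¹ = h ^ b := by rw [hR, one_div, inv_pow, inv_inv]
  calc _ ≤ (h ^ a * a.factorial * Real.exp (R * |t|)) *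
        (b.factorial * Real.exp (‖w‖ * |t| + ‖w‖ * R - t ^ 2 / 4 + R ^ 2) / R ^ b) := by gcongr
    _ = (Real.exp (R * |t|) * Real.exp (‖w‖ * |t| + ‖w‖ * R - t ^ 2 / 4 + R ^ 2)) *
        (h ^ (a + b) * a.factorial * b.factorial) := by
        rw [div_eq_mul_inv, e, pow_add]
        ring
    _ ≤ _ := by gcongr

/-! ### Partial derivatives of products of functions of separate coordinates. -/

section TensorProduct

variable {d : ℕ} {g : Fin d → ℂ → ℂ} {ψ : 𝓢(Space d, ℂ)} {γ : MultiIndex d}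

theorem derivCoord_iterate_apply_of_eq_prod (hg : ∀ i n, Differentiable ℂ (iteratedDeriv n (g i)))
    (hψ : ∀ y, ψ y = ∏ i, iteratedDeriv (γ i) (g i) (y i)) (j : Fin d) (b : ℕ) (y : Space d) :
    (derivCoord j)^[b] ψ y = ∏ i, iteratedDeriv ((γ + Pi.single j b : MultiIndex d) i) (g i) (y i) := by
  induction b generalizing y with
  | zero => simp [hψ]
  | succ b ih =>
    rw [Function.iterate_succ_apply']
    have hd : ∀ t : ℝ, HasDerivAt
        (fun t : ℝ => iteratedDeriv ((γ + Pi.single j b : MultiIndex d) j) (g j) (t : ℂ))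
        (iteratedDeriv ((γ + Pi.single j (b + 1) : MultiIndex d) j) (g j) (t : ℂ)) t := fun t => by
      have h2 := (hg j (γ j + b) (t : ℂ)).hasDerivAt.comp_ofReal
      rw [← iteratedDeriv_succ] at h2
      simpa [add_assoc] using h2
    rw [derivCoord_apply_of_eq_prod
      (g := fun i (t : ℝ) => iteratedDeriv ((γ + Pi.single j b : MultiIndex d) i) (g i) (t : ℂ))
      ih j hd, prod_update_eq, ← Finset.mul_prod_erase _ _ (Finset.mem_univ j)]
    congr 1
    exact Finset.prod_congr rfl fun i hi => by simp [Finset.ne_of_mem_erase hi]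

/-- `partialDeriv` is an ordered product over all coordinates; an arbitrary list of coordinates
makes induction possible. -/
theorem partialDeriv_list_apply_of_eq_prod (hg : ∀ i n, Differentiable ℂ (iteratedDeriv n (g i))) (β : MultiIndex d)
    (l : List (Fin d)) (hψ : ∀ y, ψ y = ∏ i, g i (y i)) (y : Space d) :
    (l.map fun i => derivCoord i ^ β i).prod ψ y =
      ∏ i, iteratedDeriv ((l.map fun i => (Pi.single i (β i) : MultiIndex d)).sum i) (g i) (y i) := by
  induction l generalizing y with
  | nil => simp [hψ]
  | cons j l ih =>
    rw [List.map_cons, List.map_cons, List.prod_cons, List.sum_cons, mul_apply_eq_comp,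
      FunLike.coe_pow_eq_iterate, derivCoord_iterate_apply_of_eq_prod hg ih, add_comm]

theorem partialDeriv_apply_of_eq_prod (hg : ∀ i n, Differentiable ℂ (iteratedDeriv n (g i))) (β : MultiIndex d)
    (hψ : ∀ y, ψ y = ∏ i, g i (y i)) (y : Space d) :
    partialDeriv β ψ y = ∏ i, iteratedDeriv (β i) (g i) (y i) := by
  have h1 : partialDeriv β = ((List.finRange d).map fun i => derivCoord i ^ β i).prod := by
    rw [partialDeriv, List.ofFn_eq_map]
    rfl
  have h2 : ((List.finRange d).map fun i => (Pi.single i (β i) : MultiIndex d)).sum = β := by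
    rw [← List.ofFn_eq_map, List.sum_ofFn, Finset.univ_sum_single]
  rw [h1, partialDeriv_list_apply_of_eq_prod hg β _ hψ, h2]

end TensorProduct

theorem gaussian_mem_sigmaOneSubmodule {d : ℕ} (w : Fin d → ℂ) :
    gaussian w ∈ sigmaOneSubmodule d := fun h hh => by
  choose C hC0 hC using fun i => exists_norm_iteratedDeriv_gaussian_le (w i) hh
  refine ⟨∏ i, C i, fun α β x => ?_⟩
  rw [partialDeriv_apply_of_eq_prod (g := fun i z => Complex.exp (w i * z - z ^ 2 / 2))
    (fun i n => ContDiff.differentiable_iteratedDeriv' n (by fun_prop)) β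
    (gaussian_apply_eq_prod w), monomial, Complex.ofReal_prod,
    ← Finset.prod_mul_distrib, norm_prod, MultiIndex.length, ← Finset.prod_pow_eq_pow_sum,
    MultiIndex.fact, MultiIndex.fact, Nat.cast_prod, Nat.cast_prod, ← Finset.prod_mul_distrib,
    ← Finset.prod_mul_distrib, ← Finset.prod_mul_distrib]
  refine Finset.prod_le_prod (fun i _ => norm_nonneg _) fun i _ => ?_
  rw [norm_mul, Complex.norm_real, Real.norm_eq_abs, abs_pow]
  exact hC i (α i) (β i) (x i)

/-- The Gaussian as an element of `Σ₁`. -/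
noncomputable def sigmaOneGaussian {d : ℕ} (w : Fin d → ℂ) : SigmaOne d :=
  (⟨gaussian w, gaussian_mem_sigmaOneSubmodule w⟩ : sigmaOneSubmodule d)

end PilipovicSpaces

namespace PilipovicSpaces

open SchwartzMap

/-! ### Pairing with Gaussians -/

theorem pairing_const_mul {d : ℕ} (u : HFlatDual d) (k : ℂ) (φ : Space d → ℂ) :
    HFlatDual.pairing u (fun y => k * φ y) = k * HFlatDual.pairing u φ := by
  have h : ∀ α, hermiteCoeff (fun y => k * φ y) α = k * hermiteCoeff φ α := fun α => by
    simp only [hermiteCoeff, mul_assoc]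
    exact MeasureTheory.integral_const_mul k _
  simp only [HFlatDual.pairing, h, mul_left_comm _ k, tsum_mul_left]

/-- The power series whose value at `w / √2` is, up to a Gaussian factor, the pairing of `u` with
the Gaussian of parameter `w` (the Bargmann transform of `u`). -/
noncomputable def bargmann {d : ℕ} (u : HFlatDual d) (ζ : Fin d → ℂ) : ℂ :=
  ∑' α : MultiIndex d, HFlatDual.coeff u α * (Real.sqrt α.fact : ℂ)⁻¹ * ∏ i, ζ i ^ α i

theorem pairing_gaussian {d : ℕ} (u : HFlatDual d) (w : Fin d → ℂ) :
    HFlatDual.pairing u (gaussian w) = gaussianConst d * Complex.exp ((∑ i, w i ^ 2) / 4) *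
      bargmann u fun i => w i / Real.sqrt 2 := by
  rw [HFlatDual.pairing, bargmann, ← tsum_mul_left]
  congr 1
  ext α
  rw [← hermiteCoeffLM_apply, hermiteCoeffLM_gaussian]
  ring

theorem norm_coeff_mul_inv_sqrt_fact {d : ℕ} (u : HFlatDual d) (α : MultiIndex d) :
    ‖HFlatDual.coeff u α * (Real.sqrt α.fact : ℂ)⁻¹‖ =
      ‖HFlatDual.coeff u α‖ * (Real.sqrt α.fact)⁻¹ := by
  rw [norm_mul, norm_inv, Complex.norm_real, Real.norm_of_nonneg (Real.sqrt_nonneg _)]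

/-- The coefficient bound of `H_♭'` holds for every `h`, so the power series converges everywhere:
`h = 1/T` with `T` larger than all `R i` gives a convergent geometric majorant. -/
theorem summable_bargmann {d : ℕ} (u : HFlatDual d) (R : Fin d → ℝ) (hR : ∀ i, 0 ≤ R i) :
    Summable fun α : MultiIndex d =>
      ‖HFlatDual.coeff u α * (Real.sqrt α.fact : ℂ)⁻¹‖ * ∏ i, R i ^ α i := by
  set T : ℝ := 2 * (1 + ∑ i, R i) with hT
  have hS : 0 ≤ ∑ i, R i := Finset.sum_nonneg fun i _ => hR i
  have hT0 : 0 < T := by positivity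
  obtain ⟨C, hC⟩ := u.2 T⁻¹ (by positivity)
  have h1 : ∀ i, Summable fun n : ℕ => (T⁻¹ * R i) ^ n := fun i => by
    refine summable_geometric_of_lt_one (mul_nonneg (by positivity) (hR i)) ?_
    rw [inv_mul_lt_iff₀ hT0, mul_one]
    have := Finset.single_le_sum (f := R) (fun i _ => hR i) (Finset.mem_univ i)
    linarith
  refine Summable.of_nonneg_of_le
    (fun α => mul_nonneg (norm_nonneg _) (Finset.prod_nonneg fun i _ => pow_nonneg (hR i) _))
    (fun α => ?_) ((summable_prod_multiIndex h1).mul_left C)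
  have hα : (0 : ℝ) < α.fact := by exact_mod_cast α.fact_pos
  have hs : 0 < Real.sqrt α.fact := Real.sqrt_pos.2 hα
  rw [norm_coeff_mul_inv_sqrt_fact]
  have h2 : ‖HFlatDual.coeff u α‖ ≤ C * (T⁻¹ ^ α.length * Real.sqrt α.fact) := hC α
  have h3 : 0 ≤ ∏ i, R i ^ α i := Finset.prod_nonneg fun i _ => pow_nonneg (hR i) _
  calc ‖HFlatDual.coeff u α‖ * (Real.sqrt α.fact)⁻¹ * ∏ i, R i ^ α i
      ≤ C * (T⁻¹ ^ α.length * Real.sqrt α.fact) * (Real.sqrt α.fact)⁻¹ * ∏ i, R i ^ α i := by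
        gcongr
    _ = C * (T⁻¹ ^ α.length * ∏ i, R i ^ α i) := by field_simp
    _ = C * ∏ i, (T⁻¹ * R i) ^ α i := by
        simp only [mul_pow, Finset.prod_mul_distrib]
        rw [Finset.prod_pow_eq_pow_sum, MultiIndex.length]

/-- The modulus of the pairing of `u` with the `L²`-normalised Gaussian of parameter `w`, up to a
constant. -/
noncomputable def gaussianTransform {d : ℕ} (u : HFlatDual d) (w : Fin d → ℂ) : ℝ :=
  Real.exp (-(∑ i, (w i).re ^ 2) / 2) * ‖HFlatDual.pairing u (gaussian w)‖

/-- As `-(Re w)²/2 + Re(w²)/4 = -|w|²/4`, the weight is the one of Bargmann–Fock space, and so is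
constant on the tori of Cauchy's estimate. -/
theorem gaussianTransform_eq {d : ℕ} (u : HFlatDual d) (w : Fin d → ℂ) :
    gaussianTransform u w = gaussianConst d * Real.exp (-(∑ i, ‖w i‖ ^ 2) / 4) *
      ‖bargmann u fun i => w i / Real.sqrt 2‖ := by
  rw [gaussianTransform, pairing_gaussian, norm_mul, norm_mul, Complex.norm_real,
    Real.norm_of_nonneg (gaussianConst_pos d).le, Complex.norm_exp, ← mul_assoc, mul_left_comm,
    ← Real.exp_add]
  congr 3
  have h1 : ((∑ i, w i ^ 2) / 4).re = (∑ i, ((w i).re ^ 2 - (w i).im ^ 2)) / 4 := by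
    rw [show (4 : ℂ) = ((4 : ℝ) : ℂ) by norm_num, Complex.div_ofReal_re, Complex.re_sum]
    congr 1
    exact Finset.sum_congr rfl fun i _ => by simp [pow_two]
  have h2 : ∑ i, ‖w i‖ ^ 2 = ∑ i, ((w i).re ^ 2 + (w i).im ^ 2) :=
    Finset.sum_congr rfl fun i _ => by
      rw [← Complex.normSq_eq_norm_sq, Complex.normSq_apply]
      ring
  rw [h1, h2, Finset.sum_sub_distrib, Finset.sum_add_distrib]
  ring

theorem gaussianTransform_zero {d : ℕ} (u : HFlatDual d) :
    gaussianTransform u 0 = gaussianConst d * ‖HFlatDual.coeff u 0‖ := by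
  have h : bargmann u (fun i => (0 : Fin d → ℂ) i / Real.sqrt 2) = HFlatDual.coeff u 0 := by
    rw [bargmann, tsum_eq_single 0]
    · simp [MultiIndex.fact]
    · intro α hα
      obtain ⟨i, hi⟩ := Function.ne_iff.mp hα
      refine mul_eq_zero_of_right _ (Finset.prod_eq_zero (Finset.mem_univ i) ?_)
      simp only [Pi.zero_apply, zero_div]
      exact zero_pow hi
  rw [gaussianTransform_eq, h]
  simp

/-- The coefficient of index `α` is controlled by the Gaussian transform on the torus of radii
`√(2 (α_i + 1))`. -/
theorem norm_coeff_le_of_gaussianTransform_le {d : ℕ} (u : HFlatDual d) (α : MultiIndex d) (M : ℝ)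
    (hM : ∀ w : Fin d → ℂ, (∀ i, ‖w i‖ ^ 2 = 2 * ((α i : ℝ) + 1)) → gaussianTransform u w ≤ M) :
    ‖HFlatDual.coeff u α‖ ≤
      (gaussianConst d)⁻¹ * Real.exp 1 ^ d * (1 + (α.length : ℝ)) ^ d * M := by
  have hκ := gaussianConst_pos d
  set R : Fin d → ℝ := fun i => Real.sqrt ((α i : ℝ) + 1) with hR
  have hR0 : ∀ i, 0 < R i := fun i => Real.sqrt_pos.2 (by positivity)
  have hR2 : ∀ i, R i ^ 2 = (α i : ℝ) + 1 := fun i => Real.sq_sqrt (by positivity)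
  set E : ℝ := ∏ i, Real.exp (((α i : ℝ) + 1) / 2) with hE
  have hE0 : 0 < E := Finset.prod_pos fun i _ => Real.exp_pos _
  have hM0 : 0 ≤ M := by
    refine le_trans ?_ (hM (fun i => ((Real.sqrt 2 * R i : ℝ) : ℂ)) fun i => ?_)
    · unfold gaussianTransform
      positivity
    · rw [Complex.norm_real, Real.norm_of_nonneg (mul_nonneg (Real.sqrt_nonneg _) (hR0 i).le),
        mul_pow, hR2, Real.sq_sqrt (by norm_num)]
  have h1 := norm_coeff_mul_le_of_torus
    (fun α : MultiIndex d => HFlatDual.coeff u α * (Real.sqrt α.fact : ℂ)⁻¹) R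
    (fun i => (hR0 i).le) (summable_bargmann u R fun i => (hR0 i).le)
    ((gaussianConst d)⁻¹ * E * M) (fun ζ hζ => by
      have h2 := hM (fun i => Real.sqrt 2 * ζ i) fun i => by
        rw [norm_mul, mul_pow, hζ, hR2, Complex.norm_real, Real.norm_of_nonneg (Real.sqrt_nonneg _),
          Real.sq_sqrt (by norm_num)]
      have h3 : (fun i => (Real.sqrt 2 : ℂ) * ζ i / Real.sqrt 2) = ζ := by
        have : (Real.sqrt 2 : ℂ) ≠ 0 := by
          have : Real.sqrt 2 ≠ 0 := by positivity
          exact_mod_cast this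
        ext i
        field_simp
      have h4 : Real.exp (-(∑ i, ‖(Real.sqrt 2 : ℂ) * ζ i‖ ^ 2) / 4) = E⁻¹ := by
        rw [hE, ← Real.exp_sum, ← Real.exp_neg]
        congr 1
        simp only [norm_mul, mul_pow, hζ, hR2, Complex.norm_real,
          Real.norm_of_nonneg (Real.sqrt_nonneg 2), Real.sq_sqrt (show (0 : ℝ) ≤ 2 by norm_num)]
        rw [← Finset.mul_sum, ← Finset.sum_div]
        ring
      rw [gaussianTransform_eq, h3, h4] at h2
      have h5 : ‖bargmann u ζ‖ = (gaussianConst d)⁻¹ * E *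
          (gaussianConst d * E⁻¹ * ‖bargmann u ζ‖) := by field_simp
      change ‖bargmann u ζ‖ ≤ _
      rw [h5]
      gcongr) α
  have hα : (0 : ℝ) < α.fact := by exact_mod_cast α.fact_pos
  have hs : 0 < Real.sqrt α.fact := Real.sqrt_pos.2 hα
  have hP : 0 < ∏ i, R i ^ α i := Finset.prod_pos fun i _ => pow_pos (hR0 i) _
  rw [norm_coeff_mul_inv_sqrt_fact] at h1
  -- The point of the chosen radii: `R^α` compensates `√α!` and the inverse Gaussian weight `E`,
  -- coordinate by coordinate, up to `e (α_i + 1)`.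
  have h6 : Real.sqrt α.fact * E ≤ Real.exp 1 ^ d * (1 + (α.length : ℝ)) ^ d * ∏ i, R i ^ α i := by
    have h7 : Real.sqrt α.fact = ∏ i, Real.sqrt (α i).factorial := by
      rw [MultiIndex.fact, Nat.cast_prod, Real.sqrt_prod _ fun i _ => by positivity]
    rw [h7, hE, ← Finset.prod_mul_distrib]
    calc _ ≤ ∏ i, (Real.exp 1 * ((α i : ℝ) + 1) * R i ^ α i) :=
          Finset.prod_le_prod (fun i _ => by positivity) fun i _ => sqrt_factorial_mul_exp_le (α i)
      _ = Real.exp 1 ^ d * (∏ i, ((α i : ℝ) + 1) ^ 1) * ∏ i, R i ^ α i := by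
          simp [Finset.prod_mul_distrib]
      _ ≤ Real.exp 1 ^ d * (1 + (α.length : ℝ)) ^ (1 * d) * ∏ i, R i ^ α i := by
          gcongr
          exact α.prod_le_one_add_length_pow 1
      _ = _ := by rw [one_mul]
  refine le_of_mul_le_mul_right ?_ hP
  calc ‖HFlatDual.coeff u α‖ * ∏ i, R i ^ α i
      = Real.sqrt α.fact * (‖HFlatDual.coeff u α‖ * (Real.sqrt α.fact)⁻¹ * ∏ i, R i ^ α i) := by
        field_simp
    _ ≤ Real.sqrt α.fact * ((gaussianConst d)⁻¹ * E * M) := by gcongr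
    _ = (gaussianConst d)⁻¹ * M * (Real.sqrt α.fact * E) := by ring
    _ ≤ (gaussianConst d)⁻¹ * M *
        (Real.exp 1 ^ d * (1 + (α.length : ℝ)) ^ d * ∏ i, R i ^ α i) := by gcongr
    _ = _ := by ring

/-- The coefficient estimate with bound zero. It makes the constructed embeddings injective. -/
theorem coeff_eq_zero_of_pairing_gaussian {d : ℕ} (u : HFlatDual d)
    (h : ∀ w : Fin d → ℂ, HFlatDual.pairing u (gaussian w) = 0) : u = 0 := by
  refine Subtype.ext (funext fun α => ?_)
  have h1 := norm_coeff_le_of_gaussianTransform_le u α 0 fun w _ => by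
    simp [gaussianTransform, h w]
  rw [mul_zero] at h1
  exact norm_le_zero_iff.1 h1

/-! ### Time-frequency shifts of Gaussians -/

/-- The displacement `iξ - x` of the parameter of a Gaussian under a time-frequency shift. -/
noncomputable def displacement {d : ℕ} (z : Space d × Space d) : Fin d → ℂ :=
  fun i => Complex.I * (z.2 i : ℂ) - (z.1 i : ℂ)

theorem displacement_add {d : ℕ} (z z' : Space d × Space d) :
    displacement (z + z') = displacement z + displacement z' := by
  ext i
  simp [displacement]
  ring

theorem shift_gaussian {d : ℕ} (x ξ : Space d) (w : Fin d → ℂ) (y : Space d) :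
    Complex.exp (Complex.I * ((⟪y + x, ξ⟫ : ℝ) : ℂ)) * gaussian w (y + x) =
      Complex.exp (∑ i, (Complex.I * ξ i * x i - (x i : ℂ) ^ 2 / 2 + w i * x i)) *
        gaussian (w + displacement (x, ξ)) y := by
  rw [gaussian_apply, gaussian_apply, ← Complex.exp_add, ← Complex.exp_add, gaussianExponent,
    gaussianExponent, PiLp.inner_apply, Complex.ofReal_sum, Finset.mul_sum,
    ← Finset.sum_add_distrib, ← Finset.sum_add_distrib]
  congr 1
  refine Finset.sum_congr rfl fun i _ => ?_
  simp [displacement]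
  ring

/-- The scalar produced by shifting a Gaussian has modulus `exp(Re w · x - |x|²/2)`, which is
exactly the change of the weight `exp(-|Re w|²/2)` when `Re w` becomes `Re w - x`. -/
theorem gaussianTransform_of_isTimeFrequencyShift {d : ℕ} {x ξ : Space d} {u u' : HFlatDual d}
    (h : HFlatDual.IsTimeFrequencyShift x ξ u u') (w : Fin d → ℂ) :
    gaussianTransform u' w = gaussianTransform u (w + displacement (x, ξ)) := by
  have h1 := h _ (gaussian_mem_HFlat w)
  simp only [shift_gaussian] at h1
  rw [pairing_const_mul] at h1
  rw [gaussianTransform, gaussianTransform, h1, norm_mul, Complex.norm_exp, ← mul_assoc,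
    ← Real.exp_add, Complex.re_sum]
  congr 2
  rw [← Finset.sum_neg_distrib, ← Finset.sum_neg_distrib, Finset.sum_div, Finset.sum_div,
    ← Finset.sum_add_distrib]
  refine Finset.sum_congr rfl fun i _ => ?_
  simp [displacement, pow_two]
  ring

section ShiftBound

variable {d : ℕ} {B : Type*}

/-- Every `f` has a translate by `a` (as far as the Gaussian transform can tell) of quasi-norm at
most `K` times the quasi-norm of `f`. -/
def ShiftBound (N : B → ℝ) (ι : B → HFlatDual d) (a : Fin d → ℂ) (K : ℝ) : Prop :=
  ∀ f, ∃ g, (∀ w, gaussianTransform (ι g) w = gaussianTransform (ι f) (w + a)) ∧ N g ≤ K * N f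

variable {N : B → ℝ} {ι : B → HFlatDual d}

theorem ShiftBound.zero : ShiftBound N ι 0 1 := fun f => ⟨f, fun w => by simp, by simp⟩

/-- Time-frequency shifts commute only up to phases; these are invisible to the transform, which is
a modulus, so shift costs simply multiply. -/
theorem ShiftBound.add {a b : Fin d → ℂ} {K L : ℝ} (ha : ShiftBound N ι a K)
    (hb : ShiftBound N ι b L) (hL : 0 ≤ L) : ShiftBound N ι (a + b) (K * L) := fun f => by
  obtain ⟨g, hg, hgN⟩ := ha f
  obtain ⟨k, hk, hkN⟩ := hb g
  refine ⟨k, fun w => ?_, ?_⟩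
  · rw [hk, hg, add_assoc, add_comm b]
  · calc N k ≤ L * N g := hkN
      _ ≤ L * (K * N f) := by gcongr
      _ = _ := by ring

theorem ShiftBound.mono {a : Fin d → ℂ} {K L : ℝ} (ha : ShiftBound N ι a K) (hN : ∀ f, 0 ≤ N f)
    (hKL : K ≤ L) : ShiftBound N ι a L := fun f => by
  obtain ⟨g, hg, hgN⟩ := ha f
  exact ⟨g, hg, hgN.trans (mul_le_mul_of_nonneg_right hKL (hN f))⟩

/-- A displacement of norm at most `n` is travelled in `n` equal steps of norm at most one. -/
theorem ShiftBound.pow {L : ℝ} (hL : 0 ≤ L)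
    (h : ∀ z : Space d × Space d, ‖z‖ ≤ 1 → ShiftBound N ι (displacement z) L) (n : ℕ)
    (z : Space d × Space d) (hz : ‖z‖ ≤ n) : ShiftBound N ι (displacement z) (L ^ n) := by
  induction n generalizing z with
  | zero =>
    have : z = 0 := by simpa using hz
    have h0 : displacement (0 : Space d × Space d) = 0 := by
      ext i
      simp [displacement]
    rw [this, h0, pow_zero]
    exact ShiftBound.zero
  | succ n ih =>
    have hn : (0 : ℝ) < (n : ℝ) + 1 := by positivity
    push_cast at hz
    have h1 : z = ((n : ℝ) / (n + 1)) • z + (1 / ((n : ℝ) + 1)) • z := by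
      rw [← add_smul, ← add_div, div_self hn.ne', one_smul]
    have h2 := ih (((n : ℝ) / (n + 1)) • z) (by
      rw [norm_smul, Real.norm_of_nonneg (by positivity), div_mul_eq_mul_div, div_le_iff₀ hn]
      gcongr)
    have h3 := h ((1 / ((n : ℝ) + 1)) • z) (by
      rw [norm_smul, Real.norm_of_nonneg (by positivity), div_mul_eq_mul_div, div_le_iff₀ hn]
      simpa using hz)
    rw [h1, displacement_add, pow_succ]
    exact h2.add h3 hL

end ShiftBound

/-! ### Local boundedness -/

/-- A locally essentially bounded function is bounded at two points whose sum is a prescribed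
vector of the unit ball. -/
theorem exists_add_eq_and_le {E : Type*} [NormedAddCommGroup E] [NormedSpace ℝ E]
    [FiniteDimensional ℝ E] [MeasurableSpace E] [BorelSpace E] (μ : MeasureTheory.Measure E)
    [μ.IsAddHaarMeasure] (v : E → ℝ)
    (hv : MeasureTheory.MemLp v ∞ (μ.restrict (Metric.closedBall 0 2))) :
    ∃ K : ℝ, ∀ z : E, ‖z‖ ≤ 1 → ∃ z₁ z₂ : E, z₁ + z₂ = z ∧ v z₁ ≤ K ∧ v z₂ ≤ K := by
  have h1 : ∀ᵐ y ∂μ.restrict (Metric.closedBall 0 2),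
      ‖v y‖ₑ ≤ MeasureTheory.eLpNormEssSup v (μ.restrict (Metric.closedBall 0 2)) :=
    MeasureTheory.ae_le_eLpNormEssSup
  have htop : MeasureTheory.eLpNormEssSup v (μ.restrict (Metric.closedBall 0 2)) ≠ ∞ := by
    have := hv.2
    rw [MeasureTheory.eLpNorm_exponent_top] at this
    exact this.ne
  set K := (MeasureTheory.eLpNormEssSup v (μ.restrict (Metric.closedBall 0 2))).toReal
  have h2 : ∀ᵐ y ∂μ, y ∈ Metric.closedBall (0 : E) 2 → v y ≤ K := by
    rw [← MeasureTheory.ae_restrict_iff' Metric.isClosed_closedBall.measurableSet]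
    filter_upwards [h1] with y hy
    have h3 := ENNReal.toReal_mono htop hy
    rw [toReal_enorm] at h3
    exact (le_abs_self _).trans h3
  refine ⟨K, fun z hz => ?_⟩
  have hz2 : ‖(1 / 2 : ℝ) • z‖ ≤ 1 := by
    rw [norm_smul]
    norm_num
    linarith
  -- Both `y ↦ z/2 + y` and `y ↦ z/2 - y` preserve the measure, so almost every `y` avoids the
  -- exceptional set for both. The unit ball has positive measure and hence contains such a `y`, and
  -- `z/2 ± y` stays in the ball of radius `2`.
  have h4 := (MeasureTheory.measurePreserving_add_left μ
    ((1 / 2 : ℝ) • z)).quasiMeasurePreserving.ae h2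
  have h5 := (MeasureTheory.Measure.measurePreserving_sub_left μ
    ((1 / 2 : ℝ) • z)).quasiMeasurePreserving.ae h2
  obtain ⟨y, hy, hy1, hy2⟩ := ((MeasureTheory.frequently_ae_mem_iff.2
    (Metric.measure_ball_pos μ (0 : E) one_pos).ne').and_eventually (h4.and h5)).exists
  rw [mem_ball_zero_iff] at hy
  refine ⟨(1 / 2 : ℝ) • z + y, (1 / 2 : ℝ) • z - y, ?_, hy1 ?_, hy2 ?_⟩
  · rw [add_add_sub_cancel, ← add_smul]
    norm_num
  · rw [mem_closedBall_zero_iff]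
    exact (norm_add_le _ _).trans (by linarith)
  · rw [mem_closedBall_zero_iff]
    exact (norm_sub_le _ _).trans (by linarith)

end PilipovicSpaces

namespace PilipovicSpaces

open SchwartzMap Topology

/-! ### Growth of the Hermite coefficients of elements of a shift-invariant space -/

theorem norm_coeff_zero_le_seminorm {d : ℕ} (u : HFlatDual d) :
    ‖HFlatDual.coeff u 0‖ ≤ HFlatDual.seminorms d ⟨1, one_pos⟩ u := by
  have h1 : ‖HFlatDual.weightedCoeff 1 0 u‖ ≤ HFlatDual.seminorms d ⟨1, one_pos⟩ u :=
    le_ciSup (HFlatDual.bddAbove_weightedCoeff ⟨1, one_pos⟩ u) 0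
  rw [HFlatDual.norm_weightedCoeff one_pos] at h1
  simpa [MultiIndex.fact] using h1

section QuasiBanach

variable {d : ℕ} {B : Type*} [AddCommGroup B] [Module ℂ B] [UniformSpace B] {N : B → ℝ}

/-- Homogeneity is enough here: `f` is rescaled to quasi-norm `r/2`, inside a ball on which `p < 1`.
-/
theorem IsQuasiBanach.exists_seminorm_le (hB : IsQuasiBanach N) (p : Seminorm ℂ B)
    (hp : ContinuousAt p 0) : ∃ K : ℝ, 0 ≤ K ∧ ∀ f, p f ≤ K * N f := by
  have h1 : ∀ᶠ f in 𝓝 (0 : B), p f < 1 := hp.eventually_lt_const (by simp)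
  obtain ⟨r, hr, h⟩ := hB.hasBasis_nhds_zero.eventually_iff.1 h1
  refine ⟨2 / r, by positivity, fun f => ?_⟩
  rcases (hB.nonneg f).eq_or_lt with h0 | h0
  · rw [hB.eq_zero f h0.symm, map_zero]
    exact mul_nonneg (by positivity) (hB.nonneg 0)
  · have ht : 0 < r / (2 * N f) := by positivity
    have h2 := @h (((r / (2 * N f) : ℝ) : ℂ) • f) (by
      simp only [Set.mem_ofPred_eq]
      rw [hB.smul, Complex.norm_real, Real.norm_of_nonneg ht.le]
      field_simp
      linarith)
    rw [map_smul_eq_mul, Complex.norm_real, Real.norm_of_nonneg ht.le, ← lt_div_iff₀' ht] at h2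
    refine h2.le.trans (le_of_eq ?_)
    field_simp

/-- A shift brings any point of the torus to the origin, where the transform is a multiple of the
coefficient of index `0` and so is controlled by the quasi-norm. Summing `|w_i|² = 2(α_i + 1)` over
`i` gives the sphere on which the shift cost `M` is required. -/
theorem exists_norm_coeff_le_of_shiftBound (hB : IsQuasiBanach N) (ι : B →L[ℂ] HFlatDual d) :
    ∃ K : ℝ, 0 ≤ K ∧ ∀ (α : MultiIndex d) (M : ℝ),
      (∀ z : Space d × Space d, ‖z.1‖ ^ 2 + ‖z.2‖ ^ 2 = 2 * (α.length + d) →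
        ShiftBound N ι (displacement z) M) →
      ∀ f, ‖HFlatDual.coeff (ι f) α‖ ≤ K * (1 + (α.length : ℝ)) ^ d * M * N f := by
  have hκ := gaussianConst_pos d
  have hcont : Continuous ((HFlatDual.seminorms d ⟨1, one_pos⟩).comp ι.toLinearMap) :=
    (HFlatDual.withSeminorms.continuous_seminorm ⟨1, one_pos⟩).comp ι.continuous
  obtain ⟨K₀, hK₀, h₀⟩ := hB.exists_seminorm_le _ hcont.continuousAt
  refine ⟨Real.exp 1 ^ d * K₀, by positivity, fun α M hM f => ?_⟩
  have h1 := norm_coeff_le_of_gaussianTransform_le (ι f) α (gaussianConst d * K₀ * (M * N f))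
    fun w hw => by
      -- The shift with `iξ - x = w`, that is `x = -Re w` and `ξ = Im w`.
      let z : Space d × Space d :=
        (WithLp.toLp 2 fun i => -(w i).re, WithLp.toLp 2 fun i => (w i).im)
      have hz : displacement z = w := by
        ext i
        simp only [displacement, z, Complex.ofReal_neg, sub_neg_eq_add]
        rw [add_comm, mul_comm]
        exact Complex.re_add_im (w i)
      have hzn : ‖z.1‖ ^ 2 + ‖z.2‖ ^ 2 = 2 * (α.length + d) := by
        rw [EuclideanSpace.norm_sq_eq, EuclideanSpace.norm_sq_eq, ← Finset.sum_add_distrib]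
        have : ∀ i, ‖z.1 i‖ ^ 2 + ‖z.2 i‖ ^ 2 = 2 * ((α i : ℝ) + 1) := fun i => by
          rw [← hw i, ← Complex.normSq_eq_norm_sq, Complex.normSq_apply]
          simp only [z, Real.norm_eq_abs, sq_abs]
          ring
        simp only [this]
        rw [← Finset.mul_sum, Finset.sum_add_distrib, MultiIndex.length]
        simp
      obtain ⟨g, hg, hgN⟩ := hM z hzn f
      have h2 := hg 0
      rw [zero_add, hz, gaussianTransform_zero] at h2
      rw [← h2, mul_assoc]
      gcongr
      refine (norm_coeff_zero_le_seminorm (ι g)).trans ((h₀ g).trans ?_)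
      gcongr
  refine h1.trans (le_of_eq ?_)
  field_simp

/-! ### Construction of the embedding into a dual space -/

/-- The common construction for `Σ₁'` and `𝓢'`. The weight `ω` measures the growth of the
coefficients of `f`; test-function coefficients decay like `s / ω` with `s` summable. The pairing is
then dominated by a constant times `N f * q φ`, whence both continuity in `φ` and uniformity on
bounded sets. -/
theorem exists_continuousLinearMap_strongDual (hB : IsQuasiBanach N) (ι : B →L[ℂ] HFlatDual d)
    {V : Type*} [AddCommGroup V] [Module ℂ V] [TopologicalSpace V] [IsTopologicalAddGroup V]
    [ContinuousSMul ℂ V] (c : MultiIndex d → V →ₗ[ℂ] ℂ) (ω s : MultiIndex d → ℝ) (A : ℝ)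
    (hA : 0 ≤ A) (hs : Summable s)
    (hcoeff : ∀ f α, ‖HFlatDual.coeff (ι f) α‖ ≤ A * ω α * N f)
    (q : Seminorm ℂ V) (hq : Continuous q) (hc : ∀ α φ, ω α * ‖c α φ‖ ≤ s α * q φ) :
    ∃ j : B →L[ℂ] StrongDual ℂ V,
      ∀ f φ, HasSum (fun α => HFlatDual.coeff (ι f) α * c α φ) (j f φ) := by
  have := hB.isUniformAddGroup
  have hterm : ∀ f φ α, ‖HFlatDual.coeff (ι f) α * c α φ‖ ≤ s α * (A * N f * q φ) :=
    fun f φ α => by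
      have hN := hB.nonneg f
      rw [norm_mul]
      calc _ ≤ A * ω α * N f * ‖c α φ‖ := by gcongr; exact hcoeff f α
        _ = A * N f * (ω α * ‖c α φ‖) := by ring
        _ ≤ A * N f * (s α * q φ) :=
            mul_le_mul_of_nonneg_left (hc α φ) (mul_nonneg hA hN)
        _ = _ := by ring
  have hsum : ∀ f φ, Summable fun α => HFlatDual.coeff (ι f) α * c α φ := fun f φ =>
    Summable.of_norm_bounded (hs.mul_right _) (hterm f φ)
  have hbound : ∀ f φ, ‖∑' α, HFlatDual.coeff (ι f) α * c α φ‖ ≤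
      (∑' α, s α) * (A * N f * q φ) := fun f φ =>
    tsum_of_norm_bounded (hs.hasSum.mul_right _) (hterm f φ)
  let J : B → V →ₗ[ℂ] ℂ := fun f =>
    { toFun := fun φ => ∑' α, HFlatDual.coeff (ι f) α * c α φ
      map_add' := fun φ χ => by
        simp only [map_add, mul_add]
        exact (hsum f φ).tsum_add (hsum f χ)
      map_smul' := fun r φ => by
        simp only [map_smul, smul_eq_mul, mul_left_comm _ r, RingHom.id_apply]
        exact tsum_mul_left }
  have hJcont : ∀ f, Continuous (J f) := fun f => by
    refine continuous_of_continuousAt_zero (J f) ?_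
    rw [ContinuousAt, map_zero]
    refine squeeze_zero_norm (hbound f) ?_
    have : Filter.Tendsto (fun φ => (∑' α, s α) * (A * N f * q φ)) (𝓝 0)
        (𝓝 ((∑' α, s α) * (A * N f * q 0))) :=
      ((hq.const_mul (A * N f)).const_mul (∑' α, s α)).tendsto 0
    simpa using this
  let j : B →ₗ[ℂ] StrongDual ℂ V :=
    { toFun := fun f => ⟨J f, hJcont f⟩
      map_add' := fun f g => by
        ext φ
        change ∑' α, HFlatDual.coeff (ι (f + g)) α * c α φ =
          ∑' α, HFlatDual.coeff (ι f) α * c α φ + ∑' α, HFlatDual.coeff (ι g) α * c α φ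
        rw [← (hsum f φ).tsum_add (hsum g φ)]
        simp only [map_add, Pi.add_apply, add_mul]
      map_smul' := fun r f => by
        ext φ
        change ∑' α, HFlatDual.coeff (ι (r • f)) α * c α φ =
          r * ∑' α, HFlatDual.coeff (ι f) α * c α φ
        rw [← tsum_mul_left]
        simp only [map_smul, Pi.smul_apply, smul_eq_mul, mul_assoc] }
  have hjcont : Continuous j := by
    refine continuous_of_continuousAt_zero j ?_
    rw [ContinuousAt, map_zero]
    refine (hB.hasBasis_nhds_zero.tendsto_iff ContinuousLinearMap.hasBasis_nhds_zero).2 ?_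
    rintro ⟨S, U⟩ ⟨hS, hU⟩
    obtain ⟨ε, hε, hεU⟩ := Metric.mem_nhds_iff.1 hU
    -- A bounded set `S` is absorbed by this neighbourhood, so `q` is bounded on `S`.
    have hq1 : {φ : V | q φ < 1} ∈ 𝓝 (0 : V) :=
      hq.continuousAt.eventually_lt_const (by simp)
    obtain ⟨r, hr, hrS⟩ := (hS hq1).exists_pos
    have hqS : ∀ φ ∈ S, q φ ≤ r := fun φ hφ => by
      obtain ⟨χ, hχ, rfl⟩ := hrS (r : ℂ) (by simp [abs_of_pos hr]) hφ
      simp only [Set.mem_ofPred_eq] at hχ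
      simp only [map_smul_eq_mul, Complex.norm_real, Real.norm_of_nonneg hr.le]
      nlinarith
    set T : ℝ := |∑' α, s α| * (A * r) with hT
    have hT0 : 0 ≤ T := by positivity
    -- `T` may vanish, hence `T + 1` in the denominator.
    refine ⟨ε / (T + 1), by positivity, fun f hf φ hφ => hεU ?_⟩
    rw [mem_ball_zero_iff]
    have hN := hB.nonneg f
    have hf' : N f * (T + 1) < ε := by
      rwa [Set.mem_ofPred_eq, lt_div_iff₀ (by positivity)] at hf
    calc ‖j f φ‖ ≤ (∑' α, s α) * (A * N f * q φ) := hbound f φ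
      _ ≤ |∑' α, s α| * (A * N f * r) := by
          gcongr
          · exact le_abs_self _
          · exact hqS φ hφ
      _ = N f * T := by rw [hT]; ring
      _ ≤ N f * (T + 1) := by gcongr; linarith
      _ < ε := hf'
  exact ⟨⟨j, hjcont⟩, fun f φ => (hsum f φ).hasSum⟩

/-- `G w` stands for the Gaussian as an element of the test space `V`. If `j f = 0`, all Gaussian
pairings of `ι f` vanish, which forces `ι f = 0`. -/
theorem injective_of_represents_gaussian {ι : B →L[ℂ] HFlatDual d} (hι : Function.Injective ι)
    {V : Type*} [AddCommGroup V] [Module ℂ V] [TopologicalSpace V] [IsTopologicalAddGroup V]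
    (j : B →L[ℂ] StrongDual ℂ V) (G : (Fin d → ℂ) → V)
    (h : ∀ f w, HasSum (fun α => HFlatDual.coeff (ι f) α * hermiteCoeff (gaussian w) α)
      (j f (G w))) : Function.Injective j := by
  refine (injective_iff_map_eq_zero j).2 fun f hf => ?_
  refine (injective_iff_map_eq_zero ι).1 hι f (coeff_eq_zero_of_pairing_gaussian _ fun w => ?_)
  have h1 := (h f w).tsum_eq
  rw [hf] at h1
  exact h1

end QuasiBanach

/-! ### Topological instances for `Σ₁` and the growth of shift costs in terms of `|α|`. -/

instance (d : ℕ) : IsTopologicalAddGroup (SigmaOne d) :=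
  SigmaOne.withSeminorms.topologicalAddGroup

instance (d : ℕ) : ContinuousSMul ℂ (SigmaOne d) :=
  SigmaOne.withSeminorms.continuousSMul

/-- The exponential growth along a geometric progression of shifts. -/
theorem pow_natCeil_sqrt_le {L : ℝ} (hL : 1 ≤ L) (a d : ℕ) :
    L ^ ⌈Real.sqrt (2 * ((a : ℝ) + d))⌉₊ ≤
      Real.exp (Real.log L * (2 * Real.sqrt d + 1)) *
        Real.exp ((2 * Real.log L + 1) * Real.sqrt a) := by
  have hl : 0 ≤ Real.log L := Real.log_nonneg hL
  have ha : (0 : ℝ) ≤ a := a.cast_nonneg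
  have hd : (0 : ℝ) ≤ d := d.cast_nonneg
  have h1 : Real.sqrt (2 * ((a : ℝ) + d)) ≤ 2 * Real.sqrt a + 2 * Real.sqrt d := by
    refine Real.sqrt_le_iff.2 ⟨by positivity, ?_⟩
    nlinarith [Real.sq_sqrt ha, Real.sq_sqrt hd, Real.sqrt_nonneg (a : ℝ),
      Real.sqrt_nonneg (d : ℝ), mul_nonneg (Real.sqrt_nonneg (a : ℝ)) (Real.sqrt_nonneg (d : ℝ))]
  have h2 := (Nat.ceil_lt_add_one (Real.sqrt_nonneg (2 * ((a : ℝ) + d)))).le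
  rw [← Real.exp_add, ← Real.rpow_natCast, Real.rpow_def_of_pos (by linarith)]
  refine Real.exp_le_exp.2 ?_
  calc Real.log L * (⌈Real.sqrt (2 * ((a : ℝ) + d))⌉₊ : ℝ)
      ≤ Real.log L * (2 * Real.sqrt a + 2 * Real.sqrt d + 1) := by gcongr; linarith
    _ ≤ _ := by nlinarith [Real.sqrt_nonneg (a : ℝ)]

/-- Converts a polynomial weight on the sphere belonging to `|α| = a` into integer powers of `1 +
|α|`; the base is at least one, so the exponent may be rounded up. -/
theorem one_add_rpow_le {x ξ n : ℝ} (hx : 0 ≤ x) (hξ : 0 ≤ ξ) (a d : ℕ)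
    (h : x ^ 2 + ξ ^ 2 = 2 * (a + d)) :
    (1 + x + ξ) ^ n ≤ (3 + 2 * (d : ℝ)) ^ ⌈n⌉₊ * (1 + (a : ℝ)) ^ ⌈n⌉₊ := by
  have ha : (0 : ℝ) ≤ a := a.cast_nonneg
  have hd : (0 : ℝ) ≤ d := d.cast_nonneg
  have h1 : 1 + x + ξ ≤ (3 + 2 * (d : ℝ)) * (1 + a) := by
    nlinarith [sq_nonneg (x - 1), sq_nonneg (ξ - 1), mul_nonneg ha hd]
  calc (1 + x + ξ) ^ n ≤ (1 + x + ξ) ^ (⌈n⌉₊ : ℝ) :=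
        Real.rpow_le_rpow_of_exponent_le (by linarith) (Nat.le_ceil n)
    _ = (1 + x + ξ) ^ ⌈n⌉₊ := Real.rpow_natCast _ _
    _ ≤ ((3 + 2 * (d : ℝ)) * (1 + a)) ^ ⌈n⌉₊ := by gcongr
    _ = _ := mul_pow _ _ _

/-- Trades `2 * d` surplus powers of decay for the summable weight. -/
theorem one_add_length_pow_mul_le {d k : ℕ} (α : MultiIndex d) {t p : ℝ}
    (h : (1 + (α.length : ℝ)) ^ (k + 2 * d) * t ≤ p) :
    (1 + (α.length : ℝ)) ^ k * t ≤ ((1 + (α.length : ℝ)) ^ (2 * d))⁻¹ * p := by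
  rw [le_inv_mul_iff₀ (by positivity)]
  refine le_trans (le_of_eq ?_) h
  rw [pow_add]
  ring

end PilipovicSpaces

/-! ### Shift costs in the given space and assembly of the two embeddings. -/

namespace PilipovicSpaces

theorem ShiftBound.of_isTimeFrequencyShift {d : ℕ} {B : Type*} {N : B → ℝ}
    {ι : B → HFlatDual d} {v : Space d × Space d → ℝ} {C : ℝ}
    (hshift : ∀ (x ξ : Space d) (f : B), ∃ g : B,
      HFlatDual.IsTimeFrequencyShift x ξ (ι f) (ι g) ∧ N g ≤ C * v (x, ξ) * N f)
    (z : Space d × Space d) : ShiftBound N ι (displacement z) (C * v z) := fun f => by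
  obtain ⟨g, hg, hgN⟩ := hshift z.1 z.2 f
  exact ⟨g, gaussianTransform_of_isTimeFrequencyShift hg, hgN⟩

/-- Essential boundedness says nothing about `v` at a given point, so each unit shift is made in two
steps through points where `v ≤ K`, at total cost `(C K)²`. Unit shifts are then iterated. -/
theorem exists_shiftBound_pow {d : ℕ} {B : Type*} {N : B → ℝ} (hN : ∀ f, 0 ≤ N f)
    {ι : B → HFlatDual d} {v : Space d × Space d → ℝ} (hv_pos : ∀ z, 0 < v z)
    (hv_loc : ∀ K : Set (Space d × Space d), IsCompact K →
      MeasureTheory.MemLp v ∞ (MeasureTheory.volume.restrict K)) {C : ℝ} (hC : 0 < C)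
    (h : ∀ z, ShiftBound N ι (displacement z) (C * v z)) :
    ∃ L : ℝ, 1 ≤ L ∧ ∀ (n : ℕ) (z : Space d × Space d), ‖z‖ ≤ n →
      ShiftBound N ι (displacement z) (L ^ n) := by
  obtain ⟨K, hK⟩ := exists_add_eq_and_le
    (MeasureTheory.volume.prod MeasureTheory.volume) v (hv_loc _ (isCompact_closedBall 0 2))
  -- The maximum with `1` ensures `log L ≥ 0`, so that enlarging the number of steps never lowers
  -- the bound.
  refine ⟨max 1 (C * K * (C * K)), le_max_left _ _, fun n z hz =>
    ShiftBound.pow (zero_le_one.trans (le_max_left _ _)) (fun z hz => ?_) n z hz⟩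
  obtain ⟨z₁, z₂, rfl, h₁, h₂⟩ := hK z hz
  have hK0 : 0 < K := (hv_pos z₁).trans_le h₁
  rw [displacement_add]
  exact (((h z₁).mono hN (by gcongr)).add ((h z₂).mono hN (L := C * K) (by gcongr))
    (by positivity)).mono hN (le_max_right _ _)

end PilipovicSpaces

theorem proposition3p2 (d : ℕ)
    {B : Type*} [AddCommGroup B] [Module ℂ B] [UniformSpace B] (N : B → ℝ)
    (hB : PilipovicSpaces.IsQuasiBanach N)
    -- the continuous embedding of `B` into `H_♭'`
    (ι : B →L[ℂ] PilipovicSpaces.HFlatDual d) (hι : Function.Injective ι)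
    -- the weight `v ∈ L^∞_loc(ℝ^{2d}; ℝ₊)`
    (v : PilipovicSpaces.Space d × PilipovicSpaces.Space d → ℝ) (hv_pos : ∀ z, 0 < v z)
    (hv_loc : ∀ K : Set (PilipovicSpaces.Space d × PilipovicSpaces.Space d), IsCompact K →
      MeasureTheory.MemLp v ∞ (MeasureTheory.volume.restrict K))
    (C : ℝ) (hC : 0 < C)
    -- `B` is closed under time-frequency shifts, with the norm estimate
    (hshift : ∀ (x ξ : PilipovicSpaces.Space d) (f : B), ∃ g : B,
      PilipovicSpaces.HFlatDual.IsTimeFrequencyShift x ξ (ι f) (ι g) ∧ N g ≤ C * v (x, ξ) * N f) :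
    (∃ j : B →L[ℂ] PilipovicSpaces.SigmaOneDual d,
      Function.Injective j ∧ ∀ f, PilipovicSpaces.SigmaOneDual.Represents (j f) (ι f)) ∧
    ((∃ C₀ > (0 : ℝ), ∃ n > (0 : ℝ), ∀ x ξ : PilipovicSpaces.Space d,
        v (x, ξ) ≤ C₀ * (1 + ‖x‖ + ‖ξ‖) ^ n) →
      ∃ j : B →L[ℂ] PilipovicSpaces.SchwartzDual d,
        Function.Injective j ∧ ∀ f, PilipovicSpaces.SchwartzDual.Represents (j f) (ι f)) := by
  have hS := fun z => PilipovicSpaces.ShiftBound.of_isTimeFrequencyShift hshift z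
  obtain ⟨K, hK, hcoeff⟩ := PilipovicSpaces.exists_norm_coeff_le_of_shiftBound hB ι
  refine ⟨?_, ?_⟩
  · obtain ⟨L, hL, hpow⟩ := PilipovicSpaces.exists_shiftBound_pow hB.nonneg hv_pos hv_loc hC hS
    have hl : 0 ≤ Real.log L := Real.log_nonneg hL
    -- The rate is the one produced by `pow_natCeil_sqrt_le`. Of the powers of `1 + |α|`, `d` offset
    -- the loss in the coefficient estimate and `2 * d` make the sum converge.
    obtain ⟨q, hq, hqc⟩ := PilipovicSpaces.exists_sigmaOne_seminorm_le d (d + 2 * d)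
      (r := 2 * Real.log L + 1) (by positivity)
    obtain ⟨j, hj⟩ := PilipovicSpaces.exists_continuousLinearMap_strongDual hB ι
      (fun α => PilipovicSpaces.hermiteCoeffLM α ∘ₗ PilipovicSpaces.SigmaOne.toSchwartz)
      (fun α => (1 + (α.length : ℝ)) ^ d *
        Real.exp ((2 * Real.log L + 1) * Real.sqrt α.length))
      (fun α => ((1 + (α.length : ℝ)) ^ (2 * d))⁻¹)
      (K * Real.exp (Real.log L * (2 * Real.sqrt d + 1)))
      (by positivity) (PilipovicSpaces.summable_one_add_length_pow d)
      (fun f α => by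
        have hN := hB.nonneg f
        refine (hcoeff α _ (fun z hz => hpow ⌈Real.sqrt (2 * ((α.length : ℝ) + d))⌉₊ z
          ((Real.le_sqrt_of_sq_le ?_).trans (Nat.le_ceil _))) f).trans ?_
        -- The norm of the product space is the maximum, which is at most the Euclidean length
        -- `√(2(|α| + d))`.
        · rw [← hz, Prod.norm_def]
          rcases max_cases ‖z.1‖ ‖z.2‖ with ⟨h, -⟩ | ⟨h, -⟩ <;> rw [h] <;>
            nlinarith [sq_nonneg ‖z.1‖, sq_nonneg ‖z.2‖]
        · calc _ ≤ K * (1 + (α.length : ℝ)) ^ d *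
                (Real.exp (Real.log L * (2 * Real.sqrt d + 1)) *
                  Real.exp ((2 * Real.log L + 1) * Real.sqrt α.length)) * N f := by
                gcongr
                exact PilipovicSpaces.pow_natCeil_sqrt_le hL α.length d
            _ = _ := by ring) q hq
      (fun α φ => by
        rw [mul_assoc]
        exact PilipovicSpaces.one_add_length_pow_mul_le α (hqc α φ))
    refine ⟨j, PilipovicSpaces.injective_of_represents_gaussian hι j
      PilipovicSpaces.sigmaOneGaussian fun f w => ?_, fun f φ => ?_⟩
    · exact hj f (PilipovicSpaces.sigmaOneGaussian w)
    · exact hj f φ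
  · rintro ⟨C₀, hC₀, n, hn, hvn⟩
    -- Powers of `1 + |α|` needed: `d` for the coefficient estimate, `⌈n⌉₊` for the weight, `2 * d`
    -- for summability.
    obtain ⟨q, hq, hqc⟩ := PilipovicSpaces.exists_schwartz_seminorm_le d (d + ⌈n⌉₊ + 2 * d)
    obtain ⟨j, hj⟩ := PilipovicSpaces.exists_continuousLinearMap_strongDual hB ι
      (fun α => PilipovicSpaces.hermiteCoeffLM α)
      (fun α => (1 + (α.length : ℝ)) ^ (d + ⌈n⌉₊))
      (fun α => ((1 + (α.length : ℝ)) ^ (2 * d))⁻¹)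
      (K * (C * (C₀ * (3 + 2 * (d : ℝ)) ^ ⌈n⌉₊)))
      (by positivity) (PilipovicSpaces.summable_one_add_length_pow d)
      (fun f α => by
        -- The polynomial bound on `v` holds at every point, so a single shift suffices and no
        -- iteration is needed.
        refine (hcoeff α (C * (C₀ * ((3 + 2 * (d : ℝ)) ^ ⌈n⌉₊ * (1 + (α.length : ℝ)) ^ ⌈n⌉₊)))
          (fun z hz => (hS z).mono hB.nonneg ?_) f).trans (le_of_eq (by ring))
        gcongr
        refine (hvn z.1 z.2).trans ?_
        gcongr
        exact PilipovicSpaces.one_add_rpow_le (norm_nonneg _) (norm_nonneg _) _ _ hz) q hq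
      (fun α φ => PilipovicSpaces.one_add_length_pow_mul_le α (hqc α φ))
    refine ⟨j, PilipovicSpaces.injective_of_represents_gaussian hι j
      PilipovicSpaces.gaussian fun f w => ?_, fun f φ => ?_⟩
    · exact hj f (PilipovicSpaces.gaussian w)
    · exact hj f φ
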